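/- Formulas are built from a countably infinite set of propositional variables with $\top$, $\bot$, $\wedge$, $\vee$, $\to$, coimplication $\prec$, and the unary modalities $\blacklozenge$ and $\Box$; put $\neg\varphi := \varphi\to\bot$, $\lrcorner\varphi := \top\prec\varphi$ and $\Diamond\varphi := \lrcorner\Box\neg\varphi$. A *bist-logic* is a set of formulas that contains the axioms $p\to(q\to p)$, $(p\to(q\to r))\to((p\to q)\to(p\to r))$, $p\to(p\vee q)$, $q\to(p\vee q)$, $(p\to r)\to((q\to r)\to(p\vee q\to r))$, $(p\wedge q)\to p$, $(p\wedge q)\to q$, $p\to(q\to p\wedge q)$, $\bot\to p$, $p\to\top$, $p\to(q\vee(p\prec q))$, $((q\vee r)\prec q)\to r$, $p\to\Box\blacklozenge p$, $\blacklozenge\Box p\to p$, and is closed under modus ponens, uniform substitution, and the rules: from $\delta_1\to\delta_2$ infer $(\delta_1\prec\psi)\to(\delta_2\prec\psi)$; from $\varphi\to\psi$ infer $\Box\varphi\to\Box\psi$ and $\blacklozenge\varphi\to\blacklozenge\psi$. $\mathbf{BiSKt}$ is the smallest bist-logic, and $\mathbf{BiSKt}\Sigma$ is the smallest bist-logic containing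 the set $\Sigma$ of formulas. An *$H$-frame* $F=(U,H,R)$ is a nonempty set $U$ with a preorder $H$ and a binary relation $R$ that is stable: $H;R;H\subseteq R$. A valuation $V$ assigns to each variable a subset of $U$ closed under $H$-successors. Satisfaction at $u\in U$ is as usual for variables, $\top$, $\bot$, $\wedge$, $\vee$, and: $u\models\varphi\to\psi$ iff for all $v$ with $uHv$, $v\models\varphi$ implies $v\models\psi$; $u\models\varphi\prec\psi$ iff for some $v$ with $vHu$, $v\models\varphi$ and $v\not\models\psi$; $u\models\blacklozenge\varphi$ iff $v\models\varphi$ for some $v$ with $vRu$; $u\models\Box\varphi$ iff $v\models\varphi$ for all $v$ with $uRv$. A formula is valid in $F$ ($F\models\varphi$) if it holds at every state under every valuation; $F\models\Lambda$ means that every formula in $\Lambda$ is valid in $F$. A bist-logic $\Lambda$ has the *finite model property* if for every $\varphi\notin\Lambda$ there is a finite $H$-frame $F$ with $F\models\Lambda$ and $F\not\models\varphi$. **Theorem.** Let $\Sigma$ be a possibly empty finite set of formulas each of the form $p\to D_1\cdots D_m p$ or $\blacklozenge p\to D_1\cdots D_m p$, where $p$ is a propositional variable, $m\ge 0$ and each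 $D_i\in\{\blacklozenge,\Diamond\}$. Then $\mathbf{BiSKt}\Sigma$ has the finite model property and is decidable. In particular, $\mathbf{BiSKt}$ is decidable. -/

import Mathlib

namespace BiSK

/-- Formulas over a countably infinite set of propositional variables (indexed by `ℕ`), with
primitive connectives `⊤`, `⊥`, `∧`, `∨`, `→`, coimplication, `◆` (`bdia`) and `□` (`box`). -/
inductive Form : Type
  | bot : Form
  | top : Form
  | var : ℕ → Form
  | and : Form → Form → Form
  | or : Form → Form → Form
  | imp : Form → Form → Form
  | coimp : Form → Form → Form
  | bdia : Form → Form
  | box : Form → Form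

namespace Form

/-- Negation `¬ φ := φ → ⊥`. -/
def neg (φ : Form) : Form := imp φ bot

/-- Co-negation: `⊤` coimplied with `φ`. -/
def coneg (φ : Form) : Form := coimp top φ

/-- The white diamond `◇ φ := coneg □ ¬ φ`. -/
def dia (φ : Form) : Form := coneg (box (neg φ))

/-- Simultaneous substitution of formulas for propositional variables. -/
def subst (σ : ℕ → Form) : Form → Form
  | bot => bot
  | top => top
  | var p => σ p
  | and φ ψ => and (subst σ φ) (subst σ ψ)
  | or φ ψ => or (subst σ φ) (subst σ ψ)
  | imp φ ψ => imp (subst σ φ) (subst σ ψ)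
  | coimp φ ψ => coimp (subst σ φ) (subst σ ψ)
  | bdia φ => bdia (subst σ φ)
  | box φ => box (subst σ φ)

/-- Gödel numbering of formulas. -/
def toNat : Form → ℕ
  | bot => 0
  | top => 1
  | var p => 7 * p + 2
  | and φ ψ => 7 * Nat.pair (toNat φ) (toNat ψ) + 3
  | or φ ψ => 7 * Nat.pair (toNat φ) (toNat ψ) + 4
  | imp φ ψ => 7 * Nat.pair (toNat φ) (toNat ψ) + 5
  | coimp φ ψ => 7 * Nat.pair (toNat φ) (toNat ψ) + 6
  | bdia φ => 7 * toNat φ + 7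
  | box φ => 7 * toNat φ + 8

/-- The formula with a given Gödel number. -/
def ofNat : ℕ → Form
  | 0 => bot
  | 1 => top
  | n + 2 =>
    have hm : n / 7 < n + 2 := by omega
    have h₁ : (Nat.unpair (n / 7)).1 < n + 2 := lt_of_le_of_lt (Nat.unpair_left_le _) hm
    have h₂ : (Nat.unpair (n / 7)).2 < n + 2 := lt_of_le_of_lt (Nat.unpair_right_le _) hm
    match n % 7 with
    | 0 => var (n / 7)
    | 1 => and (ofNat (Nat.unpair (n / 7)).1) (ofNat (Nat.unpair (n / 7)).2)
    | 2 => or (ofNat (Nat.unpair (n / 7)).1) (ofNat (Nat.unpair (n / 7)).2)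
    | 3 => imp (ofNat (Nat.unpair (n / 7)).1) (ofNat (Nat.unpair (n / 7)).2)
    | 4 => coimp (ofNat (Nat.unpair (n / 7)).1) (ofNat (Nat.unpair (n / 7)).2)
    | 5 => bdia (ofNat (n / 7))
    | _ => box (ofNat (n / 7))

theorem ofNat_toNat (φ : Form) : ofNat (toNat φ) = φ := by
  induction φ with
  | bot => simp [toNat, ofNat]
  | top => simp [toNat, ofNat]
  | var p => simp [toNat, ofNat]
  | and φ ψ h₁ h₂ =>
    have e₁ : (7 * Nat.pair (toNat φ) (toNat ψ) + 1) / 7 = Nat.pair (toNat φ) (toNat ψ) := by omega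
    have e₂ : (7 * Nat.pair (toNat φ) (toNat ψ) + 1) % 7 = 1 := by omega
    rw [toNat, ofNat, e₂, e₁]; simp [h₁, h₂]
  | or φ ψ h₁ h₂ =>
    have e₁ : (7 * Nat.pair (toNat φ) (toNat ψ) + 2) / 7 = Nat.pair (toNat φ) (toNat ψ) := by omega
    have e₂ : (7 * Nat.pair (toNat φ) (toNat ψ) + 2) % 7 = 2 := by omega
    rw [toNat, ofNat, e₂, e₁]; simp [h₁, h₂]
  | imp φ ψ h₁ h₂ =>
    have e₁ : (7 * Nat.pair (toNat φ) (toNat ψ) + 3) / 7 = Nat.pair (toNat φ) (toNat ψ) := by omega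
    have e₂ : (7 * Nat.pair (toNat φ) (toNat ψ) + 3) % 7 = 3 := by omega
    rw [toNat, ofNat, e₂, e₁]; simp [h₁, h₂]
  | coimp φ ψ h₁ h₂ =>
    have e₁ : (7 * Nat.pair (toNat φ) (toNat ψ) + 4) / 7 = Nat.pair (toNat φ) (toNat ψ) := by omega
    have e₂ : (7 * Nat.pair (toNat φ) (toNat ψ) + 4) % 7 = 4 := by omega
    rw [toNat, ofNat, e₂, e₁]; simp [h₁, h₂]
  | bdia φ h =>
    have e₁ : (7 * toNat φ + 5) / 7 = toNat φ := by omega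
    have e₂ : (7 * toNat φ + 5) % 7 = 5 := by omega
    rw [toNat, ofNat, e₂, e₁]; simp [h]
  | box φ h =>
    have e₁ : (7 * toNat φ + 6) / 7 = toNat φ := by omega
    have e₂ : (7 * toNat φ + 6) % 7 = 6 := by omega
    rw [toNat, ofNat, e₂, e₁]; simp [h]

theorem toNat_ofNat (n : ℕ) : toNat (ofNat n) = n := by
  induction n using Nat.strong_induction_on with
  | _ n ih =>
    match n with
    | 0 => simp [toNat, ofNat]
    | 1 => simp [toNat, ofNat]
    | n + 2 =>
      have hm : n / 7 < n + 2 := by omega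
      have h₀ := ih _ hm
      have h₁ := ih _ (lt_of_le_of_lt (Nat.unpair_left_le (n / 7)) hm)
      have h₂ := ih _ (lt_of_le_of_lt (Nat.unpair_right_le (n / 7)) hm)
      have hlt : n % 7 < 7 := Nat.mod_lt _ (by norm_num)
      have hd := Nat.div_add_mod n 7
      rw [ofNat]
      generalize hr : n % 7 = r at hlt hd
      interval_cases r <;> simp only [toNat, h₀, h₁, h₂, Nat.pair_unpair] <;> omega

/-- The Gödel numbering is a bijection with `ℕ`. -/
def equivNat : Form ≃ ℕ := ⟨toNat, ofNat, ofNat_toNat, toNat_ofNat⟩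

/-- Computability over formulas is computability over their Gödel numbers. -/
instance : Primcodable Form := Primcodable.ofEquiv ℕ equivNat

end Form

open Form in
/-- The axioms (A0)-(A13), in the propositional variables `p = 0`, `q = 1`, `r = 2`. -/
inductive IsAxiom : Form → Prop
  | A0 : IsAxiom (imp (var 0) (imp (var 1) (var 0)))
  | A1 : IsAxiom (imp (imp (var 0) (imp (var 1) (var 2)))
      (imp (imp (var 0) (var 1)) (imp (var 0) (var 2))))
  | A2 : IsAxiom (imp (var 0) (or (var 0) (var 1)))
  | A3 : IsAxiom (imp (var 1) (or (var 0) (var 1)))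
  | A4 : IsAxiom (imp (imp (var 0) (var 2))
      (imp (imp (var 1) (var 2)) (imp (or (var 0) (var 1)) (var 2))))
  | A5 : IsAxiom (imp (and (var 0) (var 1)) (var 0))
  | A6 : IsAxiom (imp (and (var 0) (var 1)) (var 1))
  | A7 : IsAxiom (imp (var 0) (imp (var 1) (and (var 0) (var 1))))
  | A8 : IsAxiom (imp bot (var 0))
  | A9 : IsAxiom (imp (var 0) top)
  | A10 : IsAxiom (imp (var 0) (or (var 1) (coimp (var 0) (var 1))))
  | A11 : IsAxiom (imp (coimp (or (var 1) (var 2)) (var 1)) (var 2))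
  | A12 : IsAxiom (imp (var 0) (box (bdia (var 0))))
  | A13 : IsAxiom (imp (bdia (box (var 0))) (var 0))

open Form in
/-- A bi-intuitionistic stable tense logic: a set of formulas that contains the axioms and is
closed under modus ponens, uniform substitution and the monotonicity rules. -/
structure IsBistLogic (L : Set Form) : Prop where
  ax : ∀ φ, IsAxiom φ → φ ∈ L
  mp : ∀ φ ψ, φ ∈ L → imp φ ψ ∈ L → ψ ∈ L
  us : ∀ (σ : ℕ → Form) φ, φ ∈ L → subst σ φ ∈ L
  mon_coimp : ∀ δ₁ δ₂ ψ, imp δ₁ δ₂ ∈ L → imp (coimp δ₁ ψ) (coimp δ₂ ψ) ∈ L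
  mon_box : ∀ φ ψ, imp φ ψ ∈ L → imp (box φ) (box ψ) ∈ L
  mon_bdia : ∀ φ ψ, imp φ ψ ∈ L → imp (bdia φ) (bdia ψ) ∈ L

/-- The smallest bist-logic. -/
def BiSKt : Set Form := ⋂₀ {L | IsBistLogic L}

/-- The smallest bist-logic containing the set `S` of formulas. -/
def BiSKtExt (S : Set Form) : Set Form := ⋂₀ {L | IsBistLogic L ∧ S ⊆ L}

/-- An `H`-frame: a nonempty set with a preorder `H` and a relation `R` that is stable, that is,
`H ; R ; H ⊆ R`. -/
structure HFrame where
  U : Type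
  nonempty : Nonempty U
  H : U → U → Prop
  R : U → U → Prop
  refl : ∀ x, H x x
  trans : ∀ x y z, H x y → H y z → H x z
  stable : ∀ x y z w, H x y → R y z → H z w → R x w

/-- A set closed under `H`-successors. -/
def HFrame.IsHSet (F : HFrame) (X : Set F.U) : Prop := ∀ u v, F.H u v → u ∈ X → v ∈ X

/-- A valuation: an assignment of `H`-sets to the propositional variables. -/
structure Valuation (F : HFrame) where
  val : ℕ → Set F.U
  isHSet : ∀ p, F.IsHSet (val p)

/-- Satisfaction of a formula at a state of an `H`-model. -/
def Sat (F : HFrame) (V : Valuation F) : Form → F.U → Prop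
  | .bot, _ => False
  | .top, _ => True
  | .var p, u => u ∈ V.val p
  | .and φ ψ, u => Sat F V φ u ∧ Sat F V ψ u
  | .or φ ψ, u => Sat F V φ u ∨ Sat F V ψ u
  | .imp φ ψ, u => ∀ v, F.H u v → Sat F V φ v → Sat F V ψ v
  | .coimp φ ψ, u => ∃ v, F.H v u ∧ Sat F V φ v ∧ ¬ Sat F V ψ v
  | .bdia φ, u => ∃ v, F.R v u ∧ Sat F V φ v
  | .box φ, u => ∀ v, F.R u v → Sat F V φ v

/-- Validity of a formula in a frame. -/
def HFrame.Valid (F : HFrame) (φ : Form) : Prop := ∀ (V : Valuation F) (u : F.U), Sat F V φ u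

/-- The finite model property: every non-theorem is refuted in a finite frame that validates
the logic. -/
def HasFMP (L : Set Form) : Prop :=
  ∀ φ, φ ∉ L → ∃ F : HFrame, Finite F.U ∧ (∀ ψ ∈ L, F.Valid ψ) ∧ ¬ F.Valid φ

/-- Decidability: membership is decided by an algorithm. -/
def IsDecidable (L : Set Form) : Prop := ComputablePred (fun φ : Form => φ ∈ L)

/-- The two diamonds `◆` and `◇`. -/
inductive Diamond : Type
  | black : Diamond
  | white : Diamond

/-- Application of one of the diamonds to a formula. -/
def Diamond.app : Diamond → Form → Form
  | black, φ => φ.bdia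
  | white, φ => φ.dia

/-- `diamonds [D₁, …, Dₘ] φ` is `D₁ ⋯ Dₘ φ`. -/
def diamonds (D : List Diamond) (φ : Form) : Form := D.foldr Diamond.app φ

/-- Formulas of the form `p → D₁ ⋯ Dₘ p` or `◆ p → D₁ ⋯ Dₘ p`, with `p` a propositional
variable and each `Dᵢ` one of `◆`, `◇` (`m ≥ 0`). -/
def IsDiamondAxiom (φ : Form) : Prop :=
  ∃ (p : ℕ) (D : List Diamond),
    φ = .imp (.var p) (diamonds D (.var p)) ∨ φ = .imp (.bdia (.var p)) (diamonds D (.var p))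

end BiSK

/-! An axiom `p → D p` says of a frame that each `u` lies in the set obtained by applying the
diamonds `D` to the cone of `H`-successors of `u`; `◆ p → D p` says that each `R`-successor of `v`
lies in `D` applied to the cone of `v`. Both conditions (`HFrame.Cond`) only demand that certain
paths exist, and this is what makes the proof work.

On the prime filters of the Lindenbaum algebra the required paths are built one diamond at a time
with the prime filter theorem (`mem_diasSet_canonicalFrame`). Hence the axioms are canonical, and
the logic is complete for the frames satisfying the conditions (`IsBistLogic.exists_countermodel`).

Paths are also preserved by maps that preserve `H` and `R`, so the conditions pass to the finest
filtration (`HFrame.Cond.filtration`). That filtration is finite and keeps the truth value of each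
formula used to form it (`sat_filtration`). This yields a countermodel with at most `2 ^ (N + 1)`
states for a non-theorem with code `N`.

The explicit bound gives decidability without enumerating proofs: a formula is a theorem iff no
model of bounded size refutes it. Models with their truth tables are coded by numbers below explicit
bounds, and the search is primitive recursive (`primrecPred_refutable`, `refutable_iff`). -/

namespace BiSK

open Form

/-! ### Prime filters and the canonical frame -/

/-- Prime filters of a bounded lattice. -/
@[ext]
structure PrimeFilter (A : Type) [Lattice A] [BoundedOrder A] where
  carrier : Set A
  top_mem : ⊤ ∈ carrier
  bot_notMem : ⊥ ∉ carrier
  inf_mem : ∀ a b, a ∈ carrier → b ∈ carrier → a ⊓ b ∈ carrier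
  mem_of_le : ∀ a b, a ≤ b → a ∈ carrier → b ∈ carrier
  sup_mem : ∀ a b, a ⊔ b ∈ carrier → a ∈ carrier ∨ b ∈ carrier

/-- The prime filter theorem for a down-directed set `X` and an up-directed set `Y`. -/
theorem PrimeFilter.exists_separating {A : Type} [DistribLattice A] [BoundedOrder A]
    {X Y : Set A} (hX : X.Nonempty) (hXd : DirectedOn (· ≥ ·) X) (hY : Y.Nonempty)
    (hYd : DirectedOn (· ≤ ·) Y) (hXY : ∀ x ∈ X, ∀ y ∈ Y, ¬ x ≤ y) :
    ∃ P : PrimeFilter A, X ⊆ P.carrier ∧ ∀ y ∈ Y, y ∉ P.carrier := by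
  have hI : Order.IsIdeal {a : A | ∃ y ∈ Y, a ≤ y} := by
    refine ⟨?_, ?_, ?_⟩
    · rintro a b hab ⟨y, hy, h⟩
      exact ⟨y, hy, hab.trans h⟩
    · obtain ⟨y, hy⟩ := hY
      exact ⟨y, y, hy, le_rfl⟩
    · rintro a ⟨y, hy, h⟩ b ⟨z, hz, k⟩
      obtain ⟨w, hw, hyw, hzw⟩ := hYd y hy z hz
      exact ⟨w, ⟨w, hw, le_rfl⟩, h.trans hyw, k.trans hzw⟩
  have hF : Order.IsPFilter {a : A | ∃ x ∈ X, x ≤ a} := by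
    refine .of_def ?_ ?_ ?_
    · obtain ⟨x, hx⟩ := hX
      exact ⟨x, x, hx, le_rfl⟩
    · rintro a ⟨y, hy, h⟩ b ⟨z, hz, k⟩
      obtain ⟨w, hw, hyw, hzw⟩ := hXd y hy z hz
      exact ⟨w, ⟨w, hw, le_rfl⟩, le_trans hyw h, le_trans hzw k⟩
    · rintro a b hab ⟨x, hx, h⟩
      exact ⟨x, hx, h.trans hab⟩
  have hd : Disjoint (hF.toPFilter : Set A) (hI.toIdeal : Set A) := by
    rw [Set.disjoint_left]
    rintro a ⟨x, hx, h⟩ ⟨y, hy, k⟩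
    exact hXY x hx y hy (le_trans h k)
  obtain ⟨J, hJ, hIJ, hFJ⟩ := DistribLattice.prime_ideal_of_disjoint_filter_ideal hd
  rw [Set.disjoint_left] at hFJ
  have memF : ∀ x ∈ X, x ∉ J := fun x hx => hFJ (show x ∈ hF.toPFilter from ⟨x, hx, le_rfl⟩)
  refine ⟨⟨{a | a ∉ J}, ?_, ?_, ?_, ?_, ?_⟩, memF, ?_⟩
  · obtain ⟨x, hx⟩ := hX
    exact fun h => memF x hx (J.lower le_top h)
  · simp
  · intro a b ha hb h
    exact (hJ.mem_or_mem h).elim ha hb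
  · intro a b hab ha hb
    exact ha (J.lower hab hb)
  · intro a b hab
    by_contra! h
    simp only [Set.mem_ofPred_eq, not_not] at h
    exact hab (Order.Ideal.sup_mem h.1 h.2)
  · intro y hy h
    exact h (hIJ (show y ∈ hI.toIdeal from ⟨y, hy, le_rfl⟩))

/-- The canonical frame of a nontrivial bi-Heyting algebra with a box operation `bx`. -/
@[reducible]
def canonicalFrame (A : Type) [BiheytingAlgebra A] [Nontrivial A] (bx : A → A) :
    HFrame where
  U := PrimeFilter A
  nonempty := by
    obtain ⟨P, -⟩ := PrimeFilter.exists_separating (X := {(⊤ : A)}) (Y := {⊥}) (by simp)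
      (by simp [DirectedOn]) (by simp) (by simp [DirectedOn]) (by simp)
    exact ⟨P⟩
  H P Q := P.carrier ⊆ Q.carrier
  R P Q := ∀ a, bx a ∈ P.carrier → a ∈ Q.carrier
  refl _ := subset_rfl
  trans _ _ _ := Set.Subset.trans
  stable _ _ _ _ h k l a ha := l (k a (h ha))

section Canonical

variable {A : Type} [BiheytingAlgebra A]

namespace PrimeFilter

/-- If `a ⇨ b ∉ P`, then by residuation the filter generated by `P` and `a` omits `b`, so it extends
to a prime filter omitting `b`. -/
theorem himp_mem_iff (P : PrimeFilter A) (a b : A) :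
    a ⇨ b ∈ P.carrier ↔ ∀ Q : PrimeFilter A, P.carrier ⊆ Q.carrier →
      a ∈ Q.carrier → b ∈ Q.carrier := by
  constructor
  · intro h Q hPQ ha
    exact Q.mem_of_le _ _ himp_inf_le (Q.inf_mem _ _ (hPQ h) ha)
  · intro h
    by_contra hn
    obtain ⟨Q, hQ, hbQ⟩ := exists_separating (X := {x : A | ∃ c ∈ P.carrier, x = c ⊓ a})
      (Y := {b}) ⟨_, ⊤, P.top_mem, rfl⟩ (by
        rintro _ ⟨c, hc, rfl⟩ _ ⟨d, hd, rfl⟩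
        exact ⟨_, ⟨c ⊓ d, P.inf_mem _ _ hc hd, rfl⟩, inf_le_inf_right _ inf_le_left,
          inf_le_inf_right _ inf_le_right⟩) (by simp) (by simp [DirectedOn]) (by
        rintro _ ⟨c, hc, rfl⟩ y rfl hy
        exact hn (P.mem_of_le _ _ (le_himp_iff.2 hy) hc))
    exact hbQ b rfl (h Q (fun c hc => Q.mem_of_le _ _ inf_le_left (hQ ⟨c, hc, rfl⟩))
      (Q.mem_of_le _ _ inf_le_right (hQ ⟨⊤, P.top_mem, rfl⟩)))

/-- Order-dual to `himp_mem_iff`: the complement of `P` is an ideal, and separating `a` from the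
ideal it generates together with `b` gives a prime filter inside `P`. -/
theorem sdiff_mem_iff (P : PrimeFilter A) (a b : A) :
    a \ b ∈ P.carrier ↔ ∃ Q : PrimeFilter A, Q.carrier ⊆ P.carrier ∧
      a ∈ Q.carrier ∧ b ∉ Q.carrier := by
  constructor
  · intro h
    obtain ⟨Q, hQ, hbQ⟩ := exists_separating (X := {a})
      (Y := {x : A | ∃ c, c ∉ P.carrier ∧ x = b ⊔ c}) (by simp) (by simp [DirectedOn])
      ⟨_, ⊥, P.bot_notMem, rfl⟩ (by
        rintro _ ⟨c, hc, rfl⟩ _ ⟨d, hd, rfl⟩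
        exact ⟨_, ⟨c ⊔ d, fun h => (P.sup_mem _ _ h).elim hc hd, rfl⟩,
          sup_le_sup_left le_sup_left _, sup_le_sup_left le_sup_right _⟩) (by
        rintro x rfl _ ⟨c, hc, rfl⟩ hy
        exact hc (P.mem_of_le _ _ (sdiff_le_iff.2 hy) h))
    refine ⟨Q, fun c hc => ?_, hQ rfl, fun hb =>
      hbQ _ ⟨⊥, P.bot_notMem, rfl⟩ (Q.mem_of_le _ _ le_sup_left hb)⟩
    by_contra hn
    exact hbQ _ ⟨c, hn, rfl⟩ (Q.mem_of_le _ _ le_sup_right hc)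
  · rintro ⟨Q, hQP, ha, hb⟩
    exact hQP ((Q.sup_mem _ _ (Q.mem_of_le _ _ le_sup_sdiff ha)).resolve_left hb)

variable {bd bx : A → A} (gc : GaloisConnection bd bx)
include gc

theorem box_mem_iff (P : PrimeFilter A) (a : A) :
    bx a ∈ P.carrier ↔ ∀ Q : PrimeFilter A, (∀ c, bx c ∈ P.carrier → c ∈ Q.carrier) →
      a ∈ Q.carrier := by
  refine ⟨fun h Q hQ => hQ a h, fun h => ?_⟩
  by_contra hn
  -- This `X` is a filter because the right adjoint `bx` preserves `⊤` and binary meets.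
  obtain ⟨Q, hQ, haQ⟩ := exists_separating (X := {x : A | bx x ∈ P.carrier}) (Y := {a})
    ⟨⊤, by simpa [gc.u_top] using P.top_mem⟩ (by
      intro c hc d hd
      exact ⟨c ⊓ d, by simpa [gc.u_inf] using P.inf_mem _ _ hc hd, inf_le_left, inf_le_right⟩)
    (by simp) (by simp [DirectedOn]) (by
      rintro x hx y rfl hxy
      exact hn (P.mem_of_le _ _ (gc.monotone_u hxy) hx))
  exact haQ a rfl (h Q fun c hc => hQ hc)

/-- A filter (given by a base) whose image under `bd` lies in `P` extends to a prime filter that is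
a predecessor of `P`. -/
theorem exists_pred (P : PrimeFilter A) {X : Set A} (hX : X.Nonempty)
    (hXd : DirectedOn (· ≥ ·) X) (h : ∀ a ∈ X, bd a ∈ P.carrier) :
    ∃ Q : PrimeFilter A, (∀ c, bx c ∈ Q.carrier → c ∈ P.carrier) ∧ X ⊆ Q.carrier := by
  -- This `Y` is an ideal because the left adjoint `bd` preserves `⊥` and binary joins. Avoiding it
  -- makes `Q` a predecessor of `P`, since `bd (bx c) ≤ c`.
  obtain ⟨Q, hQ, hYQ⟩ := exists_separating (Y := {y : A | bd y ∉ P.carrier}) hX hXd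
    ⟨⊥, by simpa [gc.l_bot] using P.bot_notMem⟩ (by
      intro c hc d hd
      refine ⟨c ⊔ d, fun h => ?_, le_sup_left, le_sup_right⟩
      rw [gc.l_sup] at h
      exact (P.sup_mem _ _ h).elim hc hd) (by
      intro x hx y hy hxy
      exact hy (P.mem_of_le _ _ (gc.monotone_l hxy) (h x hx)))
  refine ⟨Q, fun c hc => ?_, hQ⟩
  by_contra hn
  exact hYQ (bx c) (fun h => hn (P.mem_of_le _ _ (gc.l_u_le c) h)) hc

theorem bdia_mem_iff (P : PrimeFilter A) (a : A) :
    bd a ∈ P.carrier ↔ ∃ Q : PrimeFilter A, (∀ c, bx c ∈ Q.carrier → c ∈ P.carrier) ∧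
      a ∈ Q.carrier := by
  constructor
  · intro h
    obtain ⟨Q, hQ, ha⟩ := exists_pred gc P (X := {a}) (by simp) (by simp [DirectedOn])
      (by simpa using h)
    exact ⟨Q, hQ, ha rfl⟩
  · rintro ⟨Q, hQ, ha⟩
    exact hQ _ (Q.mem_of_le _ _ (gc.le_u_l a) ha)

/-- A filter (given by a base) whose image under `⊤ \ bx (·ᶜ)` lies in `P` extends to a prime
filter that is a successor of a subset of `P`. -/
theorem exists_succ (P : PrimeFilter A) {X : Set A} (hX : X.Nonempty)
    (hXd : DirectedOn (· ≥ ·) X) (h : ∀ a ∈ X, ⊤ \ bx aᶜ ∈ P.carrier) :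
    ∃ Q : PrimeFilter A, Q.carrier ⊆ P.carrier ∧ ∃ W : PrimeFilter A,
      (∀ c, bx c ∈ Q.carrier → c ∈ W.carrier) ∧ X ⊆ W.carrier := by
  -- `Q` must avoid everything outside `P`, which gives `Q ⊆ P`, and every `bx aᶜ` with `a ∈ X`,
  -- which leaves room for a successor containing `X`.
  obtain ⟨Q, -, hYQ⟩ := exists_separating (X := {(⊤ : A)})
    (Y := {y : A | ∃ e, e ∉ P.carrier ∧ ∃ a ∈ X, y = bx aᶜ ⊔ e}) (by simp)
    (by simp [DirectedOn])
    (by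
      obtain ⟨a, ha⟩ := hX
      exact ⟨_, ⊥, P.bot_notMem, a, ha, rfl⟩)
    (by
      rintro _ ⟨e, he, a, ha, rfl⟩ _ ⟨f, hf, b, hb, rfl⟩
      obtain ⟨c, hc, hca, hcb⟩ := hXd a ha b hb
      exact ⟨_, ⟨e ⊔ f, fun h => (P.sup_mem _ _ h).elim he hf, c, hc, rfl⟩,
        sup_le_sup (gc.monotone_u (compl_le_compl hca)) le_sup_left,
        sup_le_sup (gc.monotone_u (compl_le_compl hcb)) le_sup_right⟩)
    (by
      rintro x rfl _ ⟨e, he, a, ha, rfl⟩ hle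
      exact he (P.mem_of_le _ _ (sdiff_le_iff.2 hle) (h a ha)))
  have hQP : Q.carrier ⊆ P.carrier := by
    intro e he
    by_contra hn
    obtain ⟨a, ha⟩ := hX
    exact hYQ _ ⟨e, hn, a, ha, rfl⟩ (Q.mem_of_le _ _ le_sup_right he)
  have hbQ : ∀ a ∈ X, bx aᶜ ∉ Q.carrier := fun a ha hb =>
    hYQ _ ⟨⊥, P.bot_notMem, a, ha, rfl⟩ (Q.mem_of_le _ _ le_sup_left hb)
  -- The generated filter is proper: `c ⊓ a ≤ ⊥` would give `c ≤ aᶜ`, and then `bx c ∈ Q` would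
  -- force `bx aᶜ ∈ Q`.
  obtain ⟨W, hW, -⟩ := exists_separating
    (X := {x : A | ∃ c, bx c ∈ Q.carrier ∧ ∃ a ∈ X, x = c ⊓ a}) (Y := {⊥})
    (by
      obtain ⟨a, ha⟩ := hX
      exact ⟨_, ⊤, by simpa [gc.u_top] using Q.top_mem, a, ha, rfl⟩)
    (by
      rintro _ ⟨e, he, a, ha, rfl⟩ _ ⟨f, hf, b, hb, rfl⟩
      obtain ⟨c, hc, hca, hcb⟩ := hXd a ha b hb
      exact ⟨_, ⟨e ⊓ f, by simpa [gc.u_inf] using Q.inf_mem _ _ he hf, c, hc, rfl⟩,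
        inf_le_inf inf_le_left hca, inf_le_inf inf_le_right hcb⟩)
    (by simp) (by simp [DirectedOn])
    (by
      rintro _ ⟨c, hc, a, ha, rfl⟩ y rfl hle
      exact hbQ a ha (Q.mem_of_le _ _
        (gc.monotone_u (le_compl_iff_disjoint_right.2 (disjoint_iff_inf_le.2 hle))) hc))
  refine ⟨Q, hQP, W, fun c hc => ?_, fun a ha => ?_⟩
  · obtain ⟨a, ha⟩ := hX
    exact W.mem_of_le _ _ inf_le_left (hW ⟨c, hc, a, ha, rfl⟩)
  · exact W.mem_of_le _ _ inf_le_right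
      (hW ⟨⊤, by simpa [gc.u_top] using Q.top_mem, a, ha, rfl⟩)

end PrimeFilter

end Canonical

/-! ### Derivations in a bist-logic and its Lindenbaum algebra -/

/-- The assignment sending the variables `0`, `1`, `2` to `a`, `b`, `c`. -/
def threeVars (a b c : Form) : ℕ → Form
  | 0 => a
  | 1 => b
  | _ => c

namespace IsBistLogic

variable {L : Set Form} (hL : IsBistLogic L)
include hL

theorem ax_inst (a b c : Form) {φ : Form} (h : IsAxiom φ) : subst (threeVars a b c) φ ∈ L :=
  hL.us _ _ (hL.ax _ h)

theorem weaken (a : Form) {b : Form} (h : b ∈ L) : imp a b ∈ L :=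
  hL.mp _ _ h (hL.ax_inst b a b .A0)

theorem mp_under {a b c : Form} (h : imp a (imp b c) ∈ L) (k : imp a b ∈ L) : imp a c ∈ L :=
  hL.mp _ _ k (hL.mp _ _ h (hL.ax_inst a b c .A1))

theorem imp_trans {a b c : Form} (h : imp a b ∈ L) (k : imp b c ∈ L) : imp a c ∈ L :=
  hL.mp_under (hL.weaken a k) h

theorem imp_self (a : Form) : imp a a ∈ L :=
  hL.mp_under (hL.ax_inst a (imp a a) a .A0) (hL.ax_inst a a a .A0)

theorem imp_and {a b c : Form} (h : imp a b ∈ L) (k : imp a c ∈ L) : imp a (and b c) ∈ L :=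
  hL.mp_under (hL.imp_trans h (hL.ax_inst b c c .A7)) k

theorem or_imp {a b c : Form} (h : imp a c ∈ L) (k : imp b c ∈ L) : imp (or a b) c ∈ L :=
  hL.mp _ _ k (hL.mp _ _ h (hL.ax_inst a b c .A4))

theorem imp_imp_iff {a b c : Form} : imp a (imp b c) ∈ L ↔ imp (and a b) c ∈ L := by
  constructor
  · intro h
    exact hL.mp_under (hL.imp_trans (hL.ax_inst a b c .A5) h) (hL.ax_inst a b c .A6)
  · intro h
    exact hL.imp_trans (hL.ax_inst a b c .A7) (hL.mp _ _ (hL.weaken b h)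
      (hL.ax_inst b (and a b) c .A1))

/-- A10 and A11 are the unit and counit of this adjunction; monotonicity of coimplication supplies
the rest. -/
theorem coimp_imp_iff {a b c : Form} : imp (coimp a b) c ∈ L ↔ imp a (or b c) ∈ L := by
  constructor
  · intro h
    refine hL.imp_trans (hL.ax_inst a b c .A10) (hL.or_imp (hL.ax_inst b c c .A2) ?_)
    exact hL.imp_trans h (hL.ax_inst b c c .A3)
  · intro h
    exact hL.imp_trans (hL.mon_coimp _ _ b h) (hL.ax_inst a b c .A11)

/-- Here A12 and A13 are unit and counit. The canonical frame construction uses nothing about the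
modalities beyond this adjunction. -/
theorem bdia_imp_iff {a b : Form} : imp (bdia a) b ∈ L ↔ imp a (box b) ∈ L := by
  constructor
  · intro h
    exact hL.imp_trans (hL.ax_inst a a a .A12) (hL.mon_box _ _ h)
  · intro h
    exact hL.imp_trans (hL.mon_bdia _ _ h) (hL.ax_inst b b b .A13)

theorem mem_iff {a : Form} : a ∈ L ↔ imp top a ∈ L := by
  refine ⟨hL.weaken top, fun h => hL.mp _ _ ?_ h⟩
  -- `⊤` is not itself an axiom; it follows from the theorem `⊤ → ⊤` by A9.
  exact hL.mp _ _ (hL.imp_self top) (hL.ax_inst (imp top top) a a .A9)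

omit hL in
/-- Provable equivalence. -/
def setoid (hL : IsBistLogic L) : Setoid Form where
  r a b := imp a b ∈ L ∧ imp b a ∈ L
  iseqv :=
    { refl := fun a => ⟨hL.imp_self a, hL.imp_self a⟩
      symm := fun h => ⟨h.2, h.1⟩
      trans := fun h k => ⟨hL.imp_trans h.1 k.1, hL.imp_trans k.2 h.2⟩ }

omit hL in
/-- The Lindenbaum algebra of a bist-logic. -/
def Lindenbaum (hL : IsBistLogic L) : Type := Quotient hL.setoid

theorem or_mono {a a' b b' : Form} (h : imp a a' ∈ L) (k : imp b b' ∈ L) :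
    imp (or a b) (or a' b') ∈ L :=
  hL.or_imp (hL.imp_trans h (hL.ax_inst a' b' b' .A2))
    (hL.imp_trans k (hL.ax_inst a' b' b' .A3))

theorem and_mono {a a' b b' : Form} (h : imp a a' ∈ L) (k : imp b b' ∈ L) :
    imp (and a b) (and a' b') ∈ L :=
  hL.imp_and (hL.imp_trans (hL.ax_inst a b b .A5) h) (hL.imp_trans (hL.ax_inst a b b .A6) k)

theorem imp_mono {a a' b b' : Form} (h : imp a' a ∈ L) (k : imp b b' ∈ L) :
    imp (imp a b) (imp a' b') ∈ L :=
  hL.imp_imp_iff.2 (hL.imp_trans (hL.mp_under (hL.ax_inst (imp a b) a' a' .A5)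
    (hL.imp_trans (hL.ax_inst (imp a b) a' a' .A6) h)) k)

theorem coimp_mono {a a' b b' : Form} (h : imp a a' ∈ L) (k : imp b' b ∈ L) :
    imp (coimp a b) (coimp a' b') ∈ L :=
  hL.coimp_imp_iff.2 (hL.imp_trans (hL.imp_trans h (hL.ax_inst a' b' b' .A10))
    (hL.or_mono k (hL.imp_self _)))

namespace Lindenbaum

omit hL in
/-- The class of a formula in the Lindenbaum algebra. -/
def mk (hL : IsBistLogic L) (φ : Form) : hL.Lindenbaum := Quotient.mk hL.setoid φ

omit hL in
instance (hL : IsBistLogic L) : BiheytingAlgebra hL.Lindenbaum where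
  le := Quotient.lift₂ (fun a b => imp a b ∈ L) fun a b a' b' h k => propext
    ⟨fun l => hL.imp_trans h.2 (hL.imp_trans l k.1), fun l => hL.imp_trans h.1 (hL.imp_trans l k.2)⟩
  le_refl := by rintro ⟨a⟩; exact hL.imp_self a
  le_trans := by rintro ⟨a⟩ ⟨b⟩ ⟨c⟩ h k; exact hL.imp_trans h k
  le_antisymm := by rintro ⟨a⟩ ⟨b⟩ h k; exact Quotient.sound ⟨h, k⟩
  sup := Quotient.map₂ or fun _ _ h _ _ k => ⟨hL.or_mono h.1 k.1, hL.or_mono h.2 k.2⟩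
  inf := Quotient.map₂ and fun _ _ h _ _ k => ⟨hL.and_mono h.1 k.1, hL.and_mono h.2 k.2⟩
  himp := Quotient.map₂ imp fun _ _ h _ _ k => ⟨hL.imp_mono h.2 k.1, hL.imp_mono h.1 k.2⟩
  sdiff := Quotient.map₂ coimp fun _ _ h _ _ k => ⟨hL.coimp_mono h.1 k.2, hL.coimp_mono h.2 k.1⟩
  top := mk hL top
  bot := mk hL bot
  compl := Quotient.map neg fun _ _ h =>
    ⟨hL.imp_mono h.2 (hL.imp_self _), hL.imp_mono h.1 (hL.imp_self _)⟩
  hnot := Quotient.map coneg fun _ _ h =>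
    ⟨hL.coimp_mono (hL.imp_self _) h.2, hL.coimp_mono (hL.imp_self _) h.1⟩
  le_sup_left := by rintro ⟨a⟩ ⟨b⟩; exact hL.ax_inst a b b .A2
  le_sup_right := by rintro ⟨a⟩ ⟨b⟩; exact hL.ax_inst a b b .A3
  sup_le := by rintro ⟨a⟩ ⟨b⟩ ⟨c⟩ h k; exact hL.or_imp h k
  inf_le_left := by rintro ⟨a⟩ ⟨b⟩; exact hL.ax_inst a b b .A5
  inf_le_right := by rintro ⟨a⟩ ⟨b⟩; exact hL.ax_inst a b b .A6
  le_inf := by rintro ⟨a⟩ ⟨b⟩ ⟨c⟩ h k; exact hL.imp_and h k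
  le_top := by rintro ⟨a⟩; exact hL.ax_inst a a a .A9
  bot_le := by rintro ⟨a⟩; exact hL.ax_inst a a a .A8
  le_himp_iff := by rintro ⟨a⟩ ⟨b⟩ ⟨c⟩; exact hL.imp_imp_iff
  sdiff_le_iff := by rintro ⟨a⟩ ⟨b⟩ ⟨c⟩; exact hL.coimp_imp_iff
  himp_bot := by rintro ⟨a⟩; rfl
  top_sdiff := by rintro ⟨a⟩; rfl

omit hL in
/-- The operation `◆` on the Lindenbaum algebra. -/
def bd (hL : IsBistLogic L) : hL.Lindenbaum → hL.Lindenbaum :=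
  Quotient.map bdia fun _ _ h => ⟨hL.mon_bdia _ _ h.1, hL.mon_bdia _ _ h.2⟩

omit hL in
/-- The operation `□` on the Lindenbaum algebra. -/
def bx (hL : IsBistLogic L) : hL.Lindenbaum → hL.Lindenbaum :=
  Quotient.map box fun _ _ h => ⟨hL.mon_box _ _ h.1, hL.mon_box _ _ h.2⟩

theorem gc : GaloisConnection (bd hL) (bx hL) := by
  rintro ⟨a⟩ ⟨b⟩
  exact hL.bdia_imp_iff

theorem mk_le_mk {a b : Form} : mk hL a ≤ mk hL b ↔ imp a b ∈ L := Iff.rfl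

theorem mk_eq_top {a : Form} : mk hL a = ⊤ ↔ a ∈ L := by
  rw [hL.mem_iff, ← mk_le_mk hL]
  exact top_le_iff.symm

end Lindenbaum

end IsBistLogic

/-! ### Frame conditions of the diamond axioms -/

namespace HFrame

variable (F : HFrame)

/-- The operation on sets of states that interprets a diamond. -/
def diaSet : Diamond → Set F.U → Set F.U
  | .black, X => {u | ∃ v, F.R v u ∧ v ∈ X}
  | .white, X => {u | ∃ v, F.H v u ∧ ∃ w, F.R v w ∧ w ∈ X}

/-- The operation on sets of states that interprets a string of diamonds. -/
def diasSet (D : List Diamond) (X : Set F.U) : Set F.U := D.foldr F.diaSet X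

/-- The frame condition expressed by `p → D p` (for `b = false`) or by `◆ p → D p`
(for `b = true`). -/
def Cond : Bool → List Diamond → Prop
  | false, D => ∀ u, u ∈ F.diasSet D {x | F.H u x}
  | true, D => ∀ v u, F.R v u → u ∈ F.diasSet D {x | F.H v x}

theorem diaSet_mono (d : Diamond) : Monotone (F.diaSet d) := by
  intro X Y h
  cases d
  · rintro u ⟨v, hv, hX⟩
    exact ⟨v, hv, h hX⟩
  · rintro u ⟨v, hv, w, hw, hX⟩
    exact ⟨v, hv, w, hw, h hX⟩

theorem diasSet_mono (D : List Diamond) : Monotone (F.diasSet D) := by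
  induction D with
  | nil => exact fun _ _ h => h
  | cons d D ih => exact fun _ _ h => F.diaSet_mono d (ih h)

/-- The outermost diamond alone produces an `H`-set, by stability for `◆` and transitivity for `◇`;
the hypothesis on `X` matters only for the empty string. -/
theorem isHSet_diasSet (D : List Diamond) {X : Set F.U} (hX : F.IsHSet X) :
    F.IsHSet (F.diasSet D X) := by
  cases D with
  | nil => exact hX
  | cons d D =>
    intro u v huv
    cases d
    · rintro ⟨w, hw, h⟩
      exact ⟨w, F.stable _ _ _ _ (F.refl w) hw huv, h⟩
    · rintro ⟨w, hw, h⟩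
      exact ⟨w, F.trans _ _ _ hw huv, h⟩

end HFrame

/-- The formula `p → D p` (for `b = false`) or `◆ p → D p` (for `b = true`). -/
def diamondAxiom : Bool → ℕ → List Diamond → Form
  | false, p, D => imp (var p) (diamonds D (var p))
  | true, p, D => imp (bdia (var p)) (diamonds D (var p))

/-! ### Soundness -/

section Soundness

variable {F : HFrame} {V : Valuation F}

theorem sat_mono (φ : Form) : F.IsHSet {u | Sat F V φ u} := by
  induction φ with
  | bot => exact fun _ _ _ h => h
  | top => exact fun _ _ _ h => h
  | var p => exact V.isHSet p
  | and φ ψ h k => exact fun u v huv hu => ⟨h u v huv hu.1, k u v huv hu.2⟩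
  | or φ ψ h k => exact fun u v huv hu => hu.imp (h u v huv) (k u v huv)
  | imp φ ψ h k => exact fun u v huv hu w hvw => hu w (F.trans _ _ _ huv hvw)
  | coimp φ ψ h k =>
    rintro u v huv ⟨w, hw, h⟩
    exact ⟨w, F.trans _ _ _ hw huv, h⟩
  | bdia φ h =>
    rintro u v huv ⟨w, hw, h⟩
    exact ⟨w, F.stable _ _ _ _ (F.refl w) hw huv, h⟩
  | box φ h => exact fun u v huv hu w hvw => hu w (F.stable _ _ _ _ huv hvw (F.refl w))

/-- The negation inside `◇` adds an `H`-step after the `R`-step, which stability absorbs. -/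
theorem sat_dia (φ : Form) (u : F.U) :
    Sat F V (dia φ) u ↔ u ∈ F.diaSet .white {x | Sat F V φ x} := by
  constructor
  · rintro ⟨v, hv, -, h⟩
    simp only [Sat, neg, not_forall] at h
    obtain ⟨w, hw, x, hx, hs, -⟩ := h
    exact ⟨v, hv, x, F.stable _ _ _ _ (F.refl v) hw hx, hs⟩
  · rintro ⟨v, hv, w, hw, hs⟩
    exact ⟨v, hv, trivial, fun h => h w hw w (F.refl w) hs⟩

theorem sat_diamonds (D : List Diamond) (φ : Form) :
    {u | Sat F V (diamonds D φ) u} = F.diasSet D {u | Sat F V φ u} := by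
  induction D with
  | nil => rfl
  | cons d D ih =>
    change _ = F.diaSet d (F.diasSet D _)
    rw [← ih]
    cases d
    · rfl
    · ext u
      exact sat_dia _ u

/-- The cone of `v` is the least `H`-set containing `v`, so by monotonicity of the diamonds the
condition on cones covers every valuation. -/
theorem HFrame.Cond.valid {b : Bool} {D : List Diamond} (h : F.Cond b D) (p : ℕ) :
    F.Valid (diamondAxiom b p D) := by
  intro V u
  have key : ∀ v, v ∈ V.val p → F.diasSet D {x | F.H v x} ⊆ {u | Sat F V (diamonds D (var p)) u} := by
    intro v hv
    rw [sat_diamonds]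
    exact F.diasSet_mono D fun x hx => V.isHSet p v x hx hv
  cases b
  · exact fun v _ hs => key v hs (h v)
  · rintro v _ ⟨w, hw, hs⟩
    exact key w hs (h w v hw)

/-- The valuation induced by a substitution. -/
def Valuation.subst (V : Valuation F) (σ : ℕ → Form) : Valuation F where
  val p := {u | Sat F V (σ p) u}
  isHSet p := sat_mono (σ p)

theorem sat_subst (σ : ℕ → Form) (φ : Form) (u : F.U) :
    Sat F V (subst σ φ) u ↔ Sat F (V.subst σ) φ u := by
  induction φ generalizing u with
  | bot => rfl
  | top => rfl
  | var p => rfl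
  | and φ ψ h k => simp only [Form.subst, Sat, h, k]
  | or φ ψ h k => simp only [Form.subst, Sat, h, k]
  | imp φ ψ h k => simp only [Form.subst, Sat, h, k]
  | coimp φ ψ h k => simp only [Form.subst, Sat, h, k]
  | bdia φ h => simp only [Form.subst, Sat, h]
  | box φ h => simp only [Form.subst, Sat, h]

variable (F) in
theorem isBistLogic_valid : IsBistLogic {φ | F.Valid φ} where
  ax φ h := by
    intro V u
    have m0 := V.isHSet 0
    have m1 := V.isHSet 1
    cases h with
    | A0 => exact fun v _ h0 w hw _ => m0 v w hw h0
    | A1 =>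
      exact fun v _ h w hw k x hx l => h x (F.trans _ _ _ hw hx) l x (F.refl x) (k x hx l)
    | A2 => exact fun v _ h => Or.inl h
    | A3 => exact fun v _ h => Or.inr h
    | A4 =>
      exact fun v _ h w hw k x hx l => l.elim (h x (F.trans _ _ _ hw hx)) (k x hx)
    | A5 => exact fun v _ h => h.1
    | A6 => exact fun v _ h => h.2
    | A7 => exact fun v _ h w hw k => ⟨m0 v w hw h, k⟩
    | A8 => exact fun v _ h => h.elim
    | A9 => exact fun v _ _ => trivial
    | A10 =>
      intro v _ h
      by_cases k : Sat F V (var 1) v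
      · exact Or.inl k
      · exact Or.inr ⟨v, F.refl v, h, k⟩
    | A11 =>
      rintro v _ ⟨w, hw, h, k⟩
      exact V.isHSet 2 w v hw (h.resolve_left k)
    | A12 => exact fun v _ h w hw => ⟨v, hw, h⟩
    | A13 =>
      rintro v _ ⟨w, hw, h⟩
      exact h v hw
  mp φ ψ h k V u := k V u u (F.refl u) (h V u)
  us σ φ h V u := (sat_subst σ φ u).2 (h _ u)
  mon_coimp φ ψ χ h := by
    rintro V u v - ⟨w, hw, k, l⟩
    exact ⟨w, hw, h V w w (F.refl w) k, l⟩
  mon_box φ ψ h V u v _ k w hw := h V w w (F.refl w) (k w hw)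
  mon_bdia φ ψ h := by
    rintro V u v - ⟨w, hw, k⟩
    exact ⟨w, hw, h V w w (F.refl w) k⟩

end Soundness

/-! ### Canonicity and completeness -/

section Canonical

/-- The operation on an algebra that interprets a diamond. -/
def diaOp {A : Type} [BiheytingAlgebra A] (bd bx : A → A) : Diamond → A → A
  | .black => bd
  | .white => fun a => ⊤ \ bx aᶜ

theorem diaOp_mono {A : Type} [BiheytingAlgebra A] {bd bx : A → A} (gc : GaloisConnection bd bx)
    (d : Diamond) : Monotone (diaOp bd bx d) := by
  cases d
  · exact gc.monotone_l
  · exact fun a b h => sdiff_le_sdiff_left (gc.monotone_u (compl_le_compl h))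

theorem foldr_diaOp_mono {A : Type} [BiheytingAlgebra A] {bd bx : A → A}
    (gc : GaloisConnection bd bx) (D : List Diamond) :
    Monotone fun a => D.foldr (diaOp bd bx) a := by
  induction D with
  | nil => exact fun _ _ h => h
  | cons d D ih => exact fun _ _ h => diaOp_mono gc d (ih h)

/-- Each diamond is realised by one step of `exists_pred` or `exists_succ`, applied to the image of
`X` under the remaining diamonds. That image need not be a filter but is still down-directed, which
is why filter bases are used throughout. -/
theorem mem_diasSet_canonicalFrame {A : Type} [BiheytingAlgebra A] [Nontrivial A] {bd bx : A → A}
    (gc : GaloisConnection bd bx) (D : List Diamond) (P : PrimeFilter A) {X : Set A}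
    (hX : X.Nonempty) (hXd : DirectedOn (· ≥ ·) X)
    (h : ∀ a ∈ X, D.foldr (diaOp bd bx) a ∈ P.carrier) :
    P ∈ (canonicalFrame A bx).diasSet D {Q | X ⊆ Q.carrier} := by
  induction D generalizing P with
  | nil => exact h
  | cons d D ih =>
    have hY : ((fun a => D.foldr (diaOp bd bx) a) '' X).Nonempty := hX.image _
    have hYd : DirectedOn (· ≥ ·) ((fun a => D.foldr (diaOp bd bx) a) '' X) := by
      rintro _ ⟨a, ha, rfl⟩ _ ⟨b, hb, rfl⟩
      obtain ⟨c, hc, hca, hcb⟩ := hXd a ha b hb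
      exact ⟨_, ⟨c, hc, rfl⟩, foldr_diaOp_mono gc D hca, foldr_diaOp_mono gc D hcb⟩
    cases d
    · obtain ⟨Q, hQ, hX⟩ := P.exists_pred gc hY hYd (by
        rintro _ ⟨a, ha, rfl⟩
        exact h a ha)
      exact ⟨Q, hQ, ih Q fun a ha => hX ⟨a, ha, rfl⟩⟩
    · obtain ⟨Q, hQ, W, hW, hX⟩ := P.exists_succ gc hY hYd (by
        rintro _ ⟨a, ha, rfl⟩
        exact h a ha)
      exact ⟨Q, hQ, W, hW, ih W fun a ha => hX ⟨a, ha, rfl⟩⟩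

variable {L : Set Form} (hL : IsBistLogic L)

open IsBistLogic Lindenbaum

theorem IsBistLogic.Lindenbaum.mk_diamonds (D : List Diamond) (φ : Form) :
    mk hL (diamonds D φ) = D.foldr (diaOp (bd hL) (bx hL)) (mk hL φ) := by
  induction D with
  | nil => rfl
  | cons d D ih =>
    change mk hL (d.app (diamonds D φ)) = diaOp _ _ d (D.foldr _ _)
    rw [← ih]
    cases d <;> rfl

theorem subst_diamonds (σ : ℕ → Form) (D : List Diamond) (φ : Form) :
    subst σ (diamonds D φ) = diamonds D (subst σ φ) := by
  induction D with
  | nil => rfl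
  | cons d D ih =>
    change subst σ (d.app (diamonds D φ)) = d.app (diamonds D (subst σ φ))
    rw [← ih]
    cases d <;> rfl

variable [Nontrivial hL.Lindenbaum]

theorem canonicalFrame_cond {b : Bool} {p : ℕ} {D : List Diamond}
    (h : diamondAxiom b p D ∈ L) : (canonicalFrame hL.Lindenbaum (bx hL)).Cond b D := by
  have dir : ∀ P : PrimeFilter hL.Lindenbaum, DirectedOn (· ≥ ·) P.carrier := fun P a ha b hb =>
    ⟨a ⊓ b, P.inf_mem _ _ ha hb, inf_le_left, inf_le_right⟩
  cases b
  · intro P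
    refine mem_diasSet_canonicalFrame (gc hL) D P ⟨⊤, P.top_mem⟩ (dir P) ?_
    rintro ⟨a⟩ ha
    -- The axiom contains a single variable, so a constant substitution gives its instance at `a`.
    have k := hL.us (fun _ => a) _ h
    simp only [diamondAxiom, Form.subst, subst_diamonds] at k
    refine P.mem_of_le _ _ ?_ ha
    change mk hL a ≤ D.foldr _ (mk hL a)
    rwa [← mk_diamonds, mk_le_mk]
  · intro Q P hQP
    refine mem_diasSet_canonicalFrame (gc hL) D P ⟨⊤, Q.top_mem⟩ (dir Q) ?_
    rintro ⟨a⟩ ha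
    have k := hL.us (fun _ => a) _ h
    simp only [diamondAxiom, Form.subst, subst_diamonds] at k
    refine P.mem_of_le (mk hL (bdia a)) _ ?_ ((P.bdia_mem_iff (gc hL) (mk hL a)).2 ⟨Q, hQP, ha⟩)
    change mk hL (bdia a) ≤ D.foldr _ (mk hL a)
    rwa [← mk_diamonds, mk_le_mk]

/-- The canonical valuation. -/
@[reducible]
def canonicalValuation : Valuation (canonicalFrame hL.Lindenbaum (bx hL)) where
  val p := {P | mk hL (var p) ∈ P.carrier}
  isHSet _ _ _ h k := h k

/-- The truth lemma. -/
theorem sat_canonicalValuation (φ : Form) (P : PrimeFilter hL.Lindenbaum) :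
    Sat _ (canonicalValuation hL) φ P ↔ mk hL φ ∈ P.carrier := by
  induction φ generalizing P with
  | bot => exact ⟨False.elim, P.bot_notMem⟩
  | top => exact ⟨fun _ => P.top_mem, fun _ => trivial⟩
  | var p => rfl
  | and φ ψ h k =>
    simp only [Sat, h, k]
    exact ⟨fun l => P.inf_mem _ _ l.1 l.2, fun l =>
      ⟨P.mem_of_le (mk hL φ ⊓ mk hL ψ) _ inf_le_left l,
        P.mem_of_le (mk hL φ ⊓ mk hL ψ) _ inf_le_right l⟩⟩
  | or φ ψ h k =>
    simp only [Sat, h, k]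
    exact ⟨fun l => l.elim (P.mem_of_le _ (mk hL φ ⊔ mk hL ψ) le_sup_left)
      (P.mem_of_le _ (mk hL φ ⊔ mk hL ψ) le_sup_right), P.sup_mem (mk hL φ) (mk hL ψ)⟩
  | imp φ ψ h k =>
    simp only [Sat, h, k]
    exact (P.himp_mem_iff (mk hL φ) (mk hL ψ)).symm
  | coimp φ ψ h k =>
    simp only [Sat, h, k]
    exact (P.sdiff_mem_iff (mk hL φ) (mk hL ψ)).symm
  | bdia φ h =>
    simp only [Sat, h]
    exact (P.bdia_mem_iff (gc hL) (mk hL φ)).symm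
  | box φ h =>
    simp only [Sat, h]
    exact (P.box_mem_iff (gc hL) (mk hL φ)).symm

end Canonical

/-- A bist-logic is complete for the frames satisfying the conditions of the diamond axioms it
contains. -/
theorem IsBistLogic.exists_countermodel {L : Set Form} (hL : IsBistLogic L)
    {T : Set (Bool × List Diamond)} (hT : ∀ t ∈ T, ∃ p, diamondAxiom t.1 p t.2 ∈ L) {φ : Form}
    (hφ : φ ∉ L) :
    ∃ (F : HFrame) (V : Valuation F) (u : F.U), (∀ t ∈ T, F.Cond t.1 t.2) ∧ ¬ Sat F V φ u := by
  have hne : Lindenbaum.mk hL φ ≠ ⊤ := fun h => hφ ((Lindenbaum.mk_eq_top hL).1 h)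
  have : Nontrivial hL.Lindenbaum := ⟨_, _, hne⟩
  obtain ⟨P, -, hP⟩ := PrimeFilter.exists_separating (X := {(⊤ : hL.Lindenbaum)})
    (Y := {Lindenbaum.mk hL φ}) (by simp) (by simp [DirectedOn]) (by simp) (by simp [DirectedOn])
    (by simpa using hne)
  refine ⟨_, canonicalValuation hL, P, fun t ht => ?_, fun h => ?_⟩
  · obtain ⟨p, hp⟩ := hT t ht
    exact canonicalFrame_cond hL hp
  · exact hP _ rfl ((sat_canonicalValuation hL φ P).1 h)

/-! ### Filtration -/

section Filtration

variable (F : HFrame) (V : Valuation F) (N : ℕ)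

/-- The set of (codes of) formulas with code at most `N` that hold at `u`. -/
def truthType (u : F.U) : Set (Fin (N + 1)) := {k | Sat F V (ofNat k) u}

/-- The projection onto the filtration. -/
abbrev proj (u : F.U) : Set.range (truthType F V N) := ⟨truthType F V N u, u, rfl⟩

/-- The image of a relation in the filtration. -/
def imageRel (r : F.U → F.U → Prop) (a b : Set.range (truthType F V N)) : Prop :=
  ∃ u v, r u v ∧ proj F V N u = a ∧ proj F V N v = b

/-- The finest filtration through the formulas with code at most `N`. -/
def filtration : HFrame where
  U := Set.range (truthType F V N)
  nonempty := F.nonempty.map (proj F V N)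
  H := Relation.ReflTransGen (imageRel F V N F.H)
  -- The image of `R` need not be stable, so it is composed with the new `H` on both sides.
  R a b := ∃ u v, F.R u v ∧ Relation.ReflTransGen (imageRel F V N F.H) a (proj F V N u) ∧
    Relation.ReflTransGen (imageRel F V N F.H) (proj F V N v) b
  refl _ := .refl
  trans _ _ _ := .trans
  stable := by
    rintro x y z w hxy ⟨u, v, huv, hu, hv⟩ hzw
    exact ⟨u, v, huv, hxy.trans hu, hv.trans hzw⟩

variable {F V N}

theorem filtration_H {u v : F.U} (h : F.H u v) :
    (filtration F V N).H (proj F V N u) (proj F V N v) :=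
  .single ⟨u, v, h, rfl, rfl⟩

theorem filtration_R {u v : F.U} (h : F.R u v) :
    (filtration F V N).R (proj F V N u) (proj F V N v) :=
  ⟨u, v, h, .refl, .refl⟩

/-- The projection preserves `H` and `R`, so it carries a witnessing path to a witnessing path. -/
theorem proj_mem_diasSet (D : List Diamond) {X : Set F.U} {Y : Set (filtration F V N).U}
    (h : ∀ x ∈ X, proj F V N x ∈ Y) {u : F.U} (hu : u ∈ F.diasSet D X) :
    proj F V N u ∈ (filtration F V N).diasSet D Y := by
  induction D generalizing u with
  | nil => exact h u hu
  | cons d D ih =>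
    cases d
    · obtain ⟨v, hv, hD⟩ := hu
      exact ⟨_, filtration_R hv, ih hD⟩
    · obtain ⟨v, hv, w, hw, hD⟩ := hu
      exact ⟨_, filtration_H hv, _, filtration_R hw, ih hD⟩

theorem HFrame.Cond.filtration {b : Bool} {D : List Diamond} (h : F.Cond b D) :
    (filtration F V N).Cond b D := by
  cases b
  · rintro ⟨_, u, rfl⟩
    exact proj_mem_diasSet D (fun x hx => filtration_H hx) (h u)
  · rintro a b ⟨u, v, huv, hu, hv⟩
    -- With `a H [u]`, `u R v` and `[v] H b`, the path for `v` is projected. Its end lies in the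
    -- cone of `[u]`, hence of `a`, and closure under `H` moves its start from `[v]` to `b`.
    refine HFrame.isHSet_diasSet _ D (fun x y hxy hx => HFrame.trans _ _ _ _ hx hxy) _ _ hv ?_
    exact proj_mem_diasSet D (fun x hx => HFrame.trans _ _ _ _ hu (filtration_H hx)) (h u v huv)

/-- The formula `φ` is recorded as true at the state `a` of the filtration. -/
def Records (a : Set.range (truthType F V N)) (φ : Form) : Prop := ∃ k ∈ a.1, ofNat k.1 = φ

theorem records_proj {u : F.U} {φ : Form} (hφ : toNat φ ≤ N) :
    Records (proj F V N u) φ ↔ Sat F V φ u := by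
  constructor
  · rintro ⟨k, hk, rfl⟩
    exact hk
  · intro h
    refine ⟨⟨toNat φ, Nat.lt_succ_of_le hφ⟩, ?_, ofNat_toNat φ⟩
    change Sat F V (ofNat (toNat φ)) u
    rwa [ofNat_toNat]

theorem Records.mono {a b : Set.range (truthType F V N)} {φ : Form}
    (h : (BiSK.filtration F V N).H a b) (ha : Records a φ) : Records b φ := by
  change Relation.ReflTransGen (imageRel F V N F.H) a b at h
  induction h with
  | refl => exact ha
  | tail _ h ih =>
    obtain ⟨k, hk, rfl⟩ := ih
    obtain ⟨u, v, huv, rfl, rfl⟩ := h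
    exact ⟨k, sat_mono _ u v huv hk, rfl⟩

variable (F V N) in
/-- The valuation of the filtration. -/
def filtrationValuation : Valuation (filtration F V N) where
  val p := {a | Records a (var p)}
  isHSet _ _ _ h k := k.mono h

/-- Immediate subformulas have smaller codes, so the bound `N` plays the role of closure under
subformulas. An `H`-step of the filtration may come from a chain through several classes, but `pres`
carries truth of the recorded formulas along it. -/
theorem sat_filtration (φ : Form) (hφ : toNat φ ≤ N) (u : F.U) :
    Sat (filtration F V N) (filtrationValuation F V N) φ (proj F V N u) ↔ Sat F V φ u := by
  have pres : ∀ {ψ : Form} {u v : F.U}, toNat ψ ≤ N →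
      (filtration F V N).H (proj F V N u) (proj F V N v) → Sat F V ψ u → Sat F V ψ v :=
    fun hψ h k => (records_proj hψ).1 (((records_proj hψ).2 k).mono h)
  induction φ generalizing u with
  | bot => rfl
  | top => rfl
  | var p => exact records_proj hφ
  | and φ ψ h k =>
    have h₁ := Nat.left_le_pair (toNat φ) (toNat ψ)
    have h₂ := Nat.right_le_pair (toNat φ) (toNat ψ)
    simp only [Form.toNat] at hφ
    exact and_congr (h (by omega) u) (k (by omega) u)
  | or φ ψ h k =>
    have h₁ := Nat.left_le_pair (toNat φ) (toNat ψ)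
    have h₂ := Nat.right_le_pair (toNat φ) (toNat ψ)
    simp only [Form.toNat] at hφ
    exact or_congr (h (by omega) u) (k (by omega) u)
  | imp φ ψ h k =>
    have h₁ := Nat.left_le_pair (toNat φ) (toNat ψ)
    have h₂ := Nat.right_le_pair (toNat φ) (toNat ψ)
    have hχ := hφ
    simp only [Form.toNat] at hφ
    constructor
    · intro l v huv hv
      exact (k (by omega) v).1 (l _ (filtration_H huv) ((h (by omega) v).2 hv))
    · rintro l ⟨_, v, rfl⟩ huv hv
      exact (k (by omega) v).2 (pres hχ huv l v (F.refl v) ((h (by omega) v).1 hv))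
  | coimp φ ψ h k =>
    have h₁ := Nat.left_le_pair (toNat φ) (toNat ψ)
    have h₂ := Nat.right_le_pair (toNat φ) (toNat ψ)
    have hχ := hφ
    simp only [Form.toNat] at hφ
    constructor
    · rintro ⟨⟨_, v, rfl⟩, huv, hv, hn⟩
      exact pres hχ huv ⟨v, F.refl v, (h (by omega) v).1 hv, fun l => hn ((k (by omega) v).2 l)⟩
    · rintro ⟨v, huv, hv, hn⟩
      exact ⟨_, filtration_H huv, (h (by omega) v).2 hv, fun l => hn ((k (by omega) v).1 l)⟩
  | bdia φ h =>
    have hχ := hφ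
    simp only [Form.toNat] at hφ
    constructor
    · rintro ⟨⟨_, v, rfl⟩, ⟨x, y, hxy, hx, hy⟩, hv⟩
      exact pres hχ hy ⟨x, hxy, pres (by omega) hx ((h (by omega) v).1 hv)⟩
    · rintro ⟨v, huv, hv⟩
      exact ⟨_, filtration_R huv, (h (by omega) v).2 hv⟩
  | box φ h =>
    have hχ := hφ
    simp only [Form.toNat] at hφ
    constructor
    · intro l v huv
      exact (h (by omega) v).1 (l _ (filtration_R huv))
    · rintro l ⟨_, v, rfl⟩ ⟨x, y, hxy, hx, hy⟩
      exact (h (by omega) v).2 (pres (by omega) hy (pres hχ hx l y hxy))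

end Filtration

/-- The finite model property with an explicit bound on the size of the countermodel. -/
theorem IsBistLogic.exists_finite_countermodel {L : Set Form} (hL : IsBistLogic L)
    {T : Set (Bool × List Diamond)} (hT : ∀ t ∈ T, ∃ p, diamondAxiom t.1 p t.2 ∈ L) {φ : Form}
    (hφ : φ ∉ L) :
    ∃ (F : HFrame) (V : Valuation F) (u : F.U), Finite F.U ∧ Nat.card F.U ≤ 2 ^ (toNat φ + 1) ∧
      (∀ t ∈ T, F.Cond t.1 t.2) ∧ ¬ Sat F V φ u := by
  obtain ⟨F, V, u, hF, hu⟩ := hL.exists_countermodel hT hφ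
  refine ⟨filtration F V (toNat φ), filtrationValuation F V (toNat φ), proj F V (toNat φ) u,
    inferInstanceAs (Finite (Set.range _)), ?_, fun t ht => (hF t ht).filtration, fun h =>
      hu ((sat_filtration φ le_rfl u).1 h)⟩
  change Nat.card (Set.range (truthType F V (toNat φ))) ≤ _
  refine (Nat.card_le_card_of_injective _ Subtype.val_injective).trans ?_
  simp [Nat.card_eq_fintype_card]

/-! ### Primitive recursive predicates and bit matrices -/

section Primrec

variable {α : Type*} [Primcodable α]

theorem primrecPred_imp {p q : α → Prop} (hp : PrimrecPred p) (hq : PrimrecPred q) :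
    PrimrecPred fun a => p a → q a :=
  (hp.not.or hq).of_eq fun _ => imp_iff_not_or.symm

theorem primrecPred_iff {p q : α → Prop} (hp : PrimrecPred p) (hq : PrimrecPred q) :
    PrimrecPred fun a => (p a ↔ q a) :=
  ((primrecPred_imp hp hq).and (primrecPred_imp hq hp)).of_eq fun _ => iff_def.symm

theorem primrecPred_forall_lt {f : α → ℕ} {p : α → ℕ → Prop} (hf : Primrec f)
    (hp : PrimrecPred fun q : α × ℕ => p q.1 q.2) : PrimrecPred fun a => ∀ x < f a, p a x :=
  ((PrimrecRel.forall_mem_list (R := fun x a => p a x)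
    (hp.comp (Primrec.snd.pair Primrec.fst))).comp (Primrec.list_range.comp hf) .id).of_eq (by simp)

theorem primrecPred_exists_lt {f : α → ℕ} {p : α → ℕ → Prop} (hf : Primrec f)
    (hp : PrimrecPred fun q : α × ℕ => p q.1 q.2) : PrimrecPred fun a => ∃ x < f a, p a x :=
  ((PrimrecRel.exists_mem_list (R := fun x a => p a x)
    (hp.comp (Primrec.snd.pair Primrec.fst))).comp (Primrec.list_range.comp hf) .id).of_eq (by simp)

theorem primrecPred_const (p : Prop) : PrimrecPred fun _ : α => p := by
  by_cases h : p
  · exact (Primrec.eq.comp (.const 0) (.const 0)).of_eq fun _ => by simp [h]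
  · exact (Primrec.eq.comp (.const 0) (.const 1)).of_eq fun _ => by simp [h]

/-- A finite `T` yields one fixed finite conjunction, so its elements need no coding. -/
theorem primrecPred_forall_mem {ι : Type*} {T : Set ι} (hT : T.Finite) {p : ι → α → Prop}
    (hp : ∀ t, PrimrecPred (p t)) : PrimrecPred fun a => ∀ t ∈ T, p t a := by
  induction T, hT using Set.Finite.induction_on with
  | empty => exact (primrecPred_const True).of_eq fun _ => by simp
  | insert _ _ ih => exact ((hp _).and ih).of_eq fun _ => by rw [Set.forall_mem_insert]

/-- Uniformly primitive recursive families of binary relations on `ℕ`. -/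
def PrimrecFamily (H : α → ℕ → ℕ → Prop) : Prop :=
  PrimrecPred fun q : α × ℕ × ℕ => H q.1 q.2.1 q.2.2

theorem PrimrecFamily.comp {β : Type*} [Primcodable β] {H : α → ℕ → ℕ → Prop}
    (hH : PrimrecFamily H) {f : β → α} {g k : β → ℕ} (hf : Primrec f) (hg : Primrec g)
    (hk : Primrec k) : PrimrecPred fun b => H (f b) (g b) (k b) :=
  PrimrecPred.comp hH (hf.pair (hg.pair hk))

theorem primrec_two_pow : Primrec fun k : ℕ => 2 ^ k :=
  (Primrec.nat_rec₁ 1 (Primrec.nat_mul.comp₂ (.const 2) Primrec₂.right)).of_eq fun k => by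
    induction k with
    | zero => rfl
    | succ k ih => simp only [ih, pow_succ']

/-- The binary relation coded by the binary digits of `m`, in rows of length `n`. -/
def bitRel (n m i j : ℕ) : Prop := m / 2 ^ (i * n + j) % 2 = 1

theorem primrecFamily_bitRel {n m : α → ℕ} (hn : Primrec n) (hm : Primrec m) :
    PrimrecFamily fun a => bitRel (n a) (m a) := by
  refine Primrec.eq.comp (Primrec.nat_mod.comp (Primrec.nat_div.comp (hm.comp .fst)
    (primrec_two_pow.comp ?_)) (.const 2)) (.const 1)
  exact Primrec.nat_add.comp (Primrec.nat_mul.comp (Primrec.fst.comp .snd) (hn.comp .fst))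
    (Primrec.snd.comp .snd)

theorem exists_bitRel (l n : ℕ) (P : Fin l → Fin n → Prop) :
    ∃ m < 2 ^ (l * n), ∀ i j, bitRel n m i.1 j.1 ↔ P i j := by
  classical
  refine ⟨Nat.ofBits fun x : Fin (l * n) => decide (P (finProdFinEquiv.symm x).1
    (finProdFinEquiv.symm x).2), Nat.ofBits_lt_two_pow _, fun i j => ?_⟩
  have key : i.1 * n + j.1 = (finProdFinEquiv (i, j)).1 := by
    simp only [finProdFinEquiv_apply_val]
    ring
  have h := Nat.testBit_ofBits_lt (fun x : Fin (l * n) => decide (P (finProdFinEquiv.symm x).1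
    (finProdFinEquiv.symm x).2)) _ (finProdFinEquiv (i, j)).2
  rw [Nat.testBit_eq_decide_div_mod_eq, Fin.eta, Equiv.symm_apply_apply, decide_eq_decide] at h
  rwa [bitRel, key]

end Primrec

/-! ### Arithmetical coding of models -/

section Coding

/-- The relations `H`, `R` on `{0, …, n - 1}` form an `H`-frame. -/
def FrameCode (n : ℕ) (H R : ℕ → ℕ → Prop) : Prop :=
  (∀ i < n, H i i) ∧ (∀ i < n, ∀ j < n, ∀ k < n, H i j → H j k → H i k) ∧
    ∀ i < n, ∀ j < n, ∀ k < n, ∀ l < n, H i j → R j k → H k l → R i l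

/-- Membership of `u` in the set obtained by applying diamonds to the `H`-successors of `x`. -/
def MemDias (n : ℕ) (H R : ℕ → ℕ → Prop) : List Diamond → ℕ → ℕ → Prop
  | [], x, u => H x u
  | .black :: D, x, u => ∃ v < n, R v u ∧ MemDias n H R D x v
  | .white :: D, x, u => ∃ v < n, H v u ∧ ∃ w < n, R v w ∧ MemDias n H R D x w

/-- The arithmetical form of `HFrame.Cond`. -/
def CondCode (n : ℕ) (H R : ℕ → ℕ → Prop) : Bool → List Diamond → Prop
  | false, D => ∀ u < n, MemDias n H R D u u
  | true, D => ∀ v < n, ∀ u < n, R v u → MemDias n H R D v u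

/-- The truth table `T` is locally correct at the formula with code `k` and the state `u`. -/
def LocallyCorrect (n : ℕ) (H R T : ℕ → ℕ → Prop) (k u : ℕ) : Prop :=
  (k = 0 → ¬ T k u) ∧ (k = 1 → T k u) ∧ (2 ≤ k →
    -- A variable's row is unconstrained except for heredity: these rows are the valuation.
    ((k - 2) % 7 = 0 → ∀ v < n, H u v → T k u → T k v) ∧
    ((k - 2) % 7 = 1 → (T k u ↔ T ((k - 2) / 7).unpair.1 u ∧ T ((k - 2) / 7).unpair.2 u)) ∧
    ((k - 2) % 7 = 2 → (T k u ↔ T ((k - 2) / 7).unpair.1 u ∨ T ((k - 2) / 7).unpair.2 u)) ∧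
    ((k - 2) % 7 = 3 → (T k u ↔ ∀ v < n, H u v →
      T ((k - 2) / 7).unpair.1 v → T ((k - 2) / 7).unpair.2 v)) ∧
    ((k - 2) % 7 = 4 → (T k u ↔ ∃ v < n, H v u ∧
      T ((k - 2) / 7).unpair.1 v ∧ ¬ T ((k - 2) / 7).unpair.2 v)) ∧
    ((k - 2) % 7 = 5 → (T k u ↔ ∃ v < n, R v u ∧ T ((k - 2) / 7) v)) ∧
    ((k - 2) % 7 = 6 → (T k u ↔ ∀ v < n, R u v → T ((k - 2) / 7) v)))

/-- The formula with code `N` is refuted in a model of bounded size that satisfies the frame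
conditions in `C`. -/
def Refutable (C : Set (Bool × List Diamond)) (N : ℕ) : Prop :=
  -- The bound on `n` admits `2 ^ (N + 1)` itself; `n = 0` is excluded by the refuting state. The
  -- table `t` has one row of length `n` for each code up to `N`.
  ∃ n < 2 ^ (N + 1) + 1, ∃ h < 2 ^ (n * n), ∃ r < 2 ^ (n * n), ∃ t < 2 ^ ((N + 1) * n),
    FrameCode n (bitRel n h) (bitRel n r) ∧
    (∀ c ∈ C, CondCode n (bitRel n h) (bitRel n r) c.1 c.2) ∧
    (∀ k < N + 1, ∀ u < n, LocallyCorrect n (bitRel n h) (bitRel n r) (bitRel n t) k u) ∧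
    ∃ u < n, ¬ bitRel n t N u

variable {α : Type*} [Primcodable α] {n : α → ℕ} {H R T : α → ℕ → ℕ → Prop}

theorem primrecPred_frameCode (hn : Primrec n) (hH : PrimrecFamily H) (hR : PrimrecFamily R) :
    PrimrecPred fun a => FrameCode (n a) (H a) (R a) := by
  unfold FrameCode
  repeat' first
    | with_reducible exact Primrec.fst
    | with_reducible exact Primrec.snd
    | with_reducible exact hn
    | with_reducible apply PrimrecPred.and
    | with_reducible apply primrecPred_forall_lt
    | with_reducible apply primrecPred_imp
    | with_reducible apply hH.comp
    | with_reducible apply hR.comp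
    | with_reducible apply hn.comp
    | with_reducible apply Primrec.fst.comp
    | with_reducible apply Primrec.snd.comp

theorem primrecFamily_memDias (hn : Primrec n) (hH : PrimrecFamily H) (hR : PrimrecFamily R)
    (D : List Diamond) : PrimrecFamily fun a => MemDias (n a) (H a) (R a) D := by
  induction D with
  | nil => exact hH
  | cons d D ih =>
    cases d
    all_goals
      simp only [PrimrecFamily, MemDias]
      repeat' first
        | with_reducible exact Primrec.fst
        | with_reducible exact Primrec.snd
        | with_reducible exact hn
        | with_reducible apply PrimrecPred.and
        | with_reducible apply primrecPred_exists_lt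
        | with_reducible apply hH.comp
        | with_reducible apply hR.comp
        | with_reducible apply ih.comp
        | with_reducible apply hn.comp
        | with_reducible apply Primrec.fst.comp
        | with_reducible apply Primrec.snd.comp

theorem primrecPred_condCode (hn : Primrec n) (hH : PrimrecFamily H) (hR : PrimrecFamily R)
    (b : Bool) (D : List Diamond) : PrimrecPred fun a => CondCode (n a) (H a) (R a) b D := by
  have hD := primrecFamily_memDias hn hH hR D
  cases b
  · exact primrecPred_forall_lt hn (hD.comp .fst .snd .snd)
  · refine primrecPred_forall_lt hn (primrecPred_forall_lt (hn.comp .fst) (primrecPred_imp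
      (hR.comp (Primrec.fst.comp .fst) (Primrec.snd.comp .fst) .snd)
      (hD.comp (Primrec.fst.comp .fst) (Primrec.snd.comp .fst) .snd)))

theorem primrecFamily_locallyCorrect (hn : Primrec n) (hH : PrimrecFamily H)
    (hR : PrimrecFamily R) (hT : PrimrecFamily T) :
    PrimrecFamily fun a => LocallyCorrect (n a) (H a) (R a) (T a) := by
  unfold LocallyCorrect PrimrecFamily
  repeat' first
    | with_reducible exact Primrec.fst
    | with_reducible exact Primrec.snd
    | with_reducible exact Primrec.const _
    | with_reducible exact hn
    | with_reducible apply PrimrecPred.and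
    | with_reducible apply PrimrecPred.or
    | with_reducible apply PrimrecPred.not
    | with_reducible apply primrecPred_iff
    | with_reducible apply primrecPred_forall_lt
    | with_reducible apply primrecPred_exists_lt
    | with_reducible apply primrecPred_imp
    | with_reducible apply Primrec.eq.comp
    | with_reducible apply Primrec.nat_le.comp
    | with_reducible apply hH.comp
    | with_reducible apply hR.comp
    | with_reducible apply hT.comp
    | with_reducible apply hn.comp
    | with_reducible apply Primrec.nat_mod.comp
    | with_reducible apply Primrec.nat_div.comp
    | with_reducible apply Primrec.nat_sub.comp
    | with_reducible apply Primrec.unpair.comp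
    | with_reducible apply Primrec.fst.comp
    | with_reducible apply Primrec.snd.comp

theorem primrecPred_refutable {C : Set (Bool × List Diamond)} (hC : C.Finite) :
    PrimrecPred (Refutable C) := by
  have sq : ∀ {β : Type} [Primcodable β] {f g : β → ℕ}, Primrec f → Primrec g →
      Primrec fun b => 2 ^ (f b * g b) := fun hf hg =>
    primrec_two_pow.comp (Primrec.nat_mul.comp hf hg)
  -- Nested quantifiers pair to the left, so `q` is `((((N, n), h), r), t)`.
  have hn : Primrec fun q : (((ℕ × ℕ) × ℕ) × ℕ) × ℕ => q.1.1.1.2 :=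
    Primrec.snd.comp (Primrec.fst.comp (Primrec.fst.comp .fst))
  have hN : Primrec fun q : (((ℕ × ℕ) × ℕ) × ℕ) × ℕ => q.1.1.1.1 :=
    Primrec.fst.comp (Primrec.fst.comp (Primrec.fst.comp .fst))
  have hH := primrecFamily_bitRel hn (Primrec.snd.comp (Primrec.fst.comp .fst))
  have hR := primrecFamily_bitRel hn (Primrec.snd.comp .fst)
  have hT := primrecFamily_bitRel hn Primrec.snd
  refine primrecPred_exists_lt (Primrec.succ.comp (primrec_two_pow.comp Primrec.succ))
    (primrecPred_exists_lt (sq .snd .snd)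
    (primrecPred_exists_lt (sq (Primrec.snd.comp .fst) (Primrec.snd.comp .fst))
    (primrecPred_exists_lt (sq (Primrec.succ.comp (Primrec.fst.comp (Primrec.fst.comp .fst)))
      (Primrec.snd.comp (Primrec.fst.comp .fst))) ?_)))
  refine (primrecPred_frameCode hn hH hR).and (.and ?_ (.and ?_ ?_))
  · exact primrecPred_forall_mem hC fun c => primrecPred_condCode hn hH hR c.1 c.2
  · exact primrecPred_forall_lt (Primrec.succ.comp hN) (primrecPred_forall_lt (hn.comp .fst)
      ((primrecFamily_locallyCorrect hn hH hR hT).comp (Primrec.fst.comp .fst)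
        (Primrec.snd.comp .fst) .snd))
  · exact primrecPred_exists_lt hn (hT.comp .fst (hN.comp .fst) .snd).not

end Coding

/-! ### Correctness of the coding -/

section Correctness

/-- Codes `0` and `1` belong to `⊥` and `⊤`; after subtracting `2`, the remainder mod `7` names the
constructor and the quotient its argument. -/
theorem code_arith {k c i : ℕ} (hk : k = 7 * c + (i + 2)) (hi : i < 7) :
    k ≠ 0 ∧ k ≠ 1 ∧ 2 ≤ k ∧ (k - 2) % 7 = i ∧ (k - 2) / 7 = c := by
  omega

namespace LocallyCorrect

variable {n : ℕ} {H R T : ℕ → ℕ → Prop} {u : ℕ}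

theorem bot_iff : LocallyCorrect n H R T (Form.toNat bot) u ↔ ¬ T (Form.toNat bot) u := by
  simp [LocallyCorrect, Form.toNat]

theorem top_iff : LocallyCorrect n H R T (Form.toNat top) u ↔ T (Form.toNat top) u := by
  simp [LocallyCorrect, Form.toNat]

theorem var_iff (p : ℕ) : LocallyCorrect n H R T (Form.toNat (var p)) u ↔
    ∀ v < n, H u v → T (Form.toNat (var p)) u → T (Form.toNat (var p)) v := by
  generalize hk : Form.toNat (var p) = k
  obtain ⟨h₀, h₁, h₂, h₃, h₄⟩ := code_arith (i := 0) hk.symm (by norm_num)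
  simp [LocallyCorrect, h₀, h₁, h₂, h₃, h₄]

theorem and_iff (φ ψ : Form) : LocallyCorrect n H R T (Form.toNat (and φ ψ)) u ↔
    (T (Form.toNat (and φ ψ)) u ↔ T (Form.toNat φ) u ∧ T (Form.toNat ψ) u) := by
  generalize hk : Form.toNat (and φ ψ) = k
  obtain ⟨h₀, h₁, h₂, h₃, h₄⟩ := code_arith (i := 1) hk.symm (by norm_num)
  simp [LocallyCorrect, h₀, h₁, h₂, h₃, h₄]

theorem or_iff (φ ψ : Form) : LocallyCorrect n H R T (Form.toNat (or φ ψ)) u ↔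
    (T (Form.toNat (or φ ψ)) u ↔ T (Form.toNat φ) u ∨ T (Form.toNat ψ) u) := by
  generalize hk : Form.toNat (or φ ψ) = k
  obtain ⟨h₀, h₁, h₂, h₃, h₄⟩ := code_arith (i := 2) hk.symm (by norm_num)
  simp [LocallyCorrect, h₀, h₁, h₂, h₃, h₄]

theorem imp_iff (φ ψ : Form) : LocallyCorrect n H R T (Form.toNat (imp φ ψ)) u ↔
    (T (Form.toNat (imp φ ψ)) u ↔ ∀ v < n, H u v → T (Form.toNat φ) v → T (Form.toNat ψ) v) := by
  generalize hk : Form.toNat (imp φ ψ) = k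
  obtain ⟨h₀, h₁, h₂, h₃, h₄⟩ := code_arith (i := 3) hk.symm (by norm_num)
  simp [LocallyCorrect, h₀, h₁, h₂, h₃, h₄]

theorem coimp_iff (φ ψ : Form) : LocallyCorrect n H R T (Form.toNat (coimp φ ψ)) u ↔
    (T (Form.toNat (coimp φ ψ)) u ↔ ∃ v < n, H v u ∧ T (Form.toNat φ) v ∧ ¬ T (Form.toNat ψ) v) := by
  generalize hk : Form.toNat (coimp φ ψ) = k
  obtain ⟨h₀, h₁, h₂, h₃, h₄⟩ := code_arith (i := 4) hk.symm (by norm_num)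
  simp [LocallyCorrect, h₀, h₁, h₂, h₃, h₄]

theorem bdia_iff (φ : Form) : LocallyCorrect n H R T (Form.toNat (bdia φ)) u ↔
    (T (Form.toNat (bdia φ)) u ↔ ∃ v < n, R v u ∧ T (Form.toNat φ) v) := by
  generalize hk : Form.toNat (bdia φ) = k
  obtain ⟨h₀, h₁, h₂, h₃, h₄⟩ := code_arith (i := 5) hk.symm (by norm_num)
  simp [LocallyCorrect, h₀, h₁, h₂, h₃, h₄]

theorem box_iff (φ : Form) : LocallyCorrect n H R T (Form.toNat (box φ)) u ↔
    (T (Form.toNat (box φ)) u ↔ ∀ v < n, R u v → T (Form.toNat φ) v) := by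
  generalize hk : Form.toNat (box φ) = k
  obtain ⟨h₀, h₁, h₂, h₃, h₄⟩ := code_arith (i := 6) hk.symm (by norm_num)
  simp [LocallyCorrect, h₀, h₁, h₂, h₃, h₄]

end LocallyCorrect

variable {F : HFrame} {n : ℕ} {H R T : ℕ → ℕ → Prop} (e : Fin n ≃ F.U)
  (hH : ∀ i j : Fin n, H i j ↔ F.H (e i) (e j)) (hR : ∀ i j : Fin n, R i j ↔ F.R (e i) (e j))

theorem exists_lt_iff_exists {n : ℕ} {U : Type} (e : Fin n ≃ U) {p : ℕ → Prop} {q : U → Prop}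
    (h : ∀ i : Fin n, p i ↔ q (e i)) : (∃ i < n, p i) ↔ ∃ u, q u := by
  rw [← e.exists_congr_right, Fin.exists_iff]
  simp only [← h, exists_prop]

theorem forall_lt_iff_forall {n : ℕ} {U : Type} (e : Fin n ≃ U) {p : ℕ → Prop} {q : U → Prop}
    (h : ∀ i : Fin n, p i ↔ q (e i)) : (∀ i < n, p i) ↔ ∀ u, q u := by
  rw [← e.forall_congr_right, Fin.forall_iff]
  simp only [← h]

include hH hR

theorem frameCode_of_equiv : FrameCode n H R := by
  refine ⟨fun i hi => (hH ⟨i, hi⟩ ⟨i, hi⟩).2 (F.refl _), fun i hi j hj k hk h h' => ?_,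
    fun i hi j hj k hk l hl h h' h'' => ?_⟩
  · exact (hH ⟨i, hi⟩ ⟨k, hk⟩).2 (F.trans _ _ _ ((hH ⟨i, hi⟩ ⟨j, hj⟩).1 h)
      ((hH ⟨j, hj⟩ ⟨k, hk⟩).1 h'))
  · exact (hR ⟨i, hi⟩ ⟨l, hl⟩).2 (F.stable _ _ _ _ ((hH ⟨i, hi⟩ ⟨j, hj⟩).1 h)
      ((hR ⟨j, hj⟩ ⟨k, hk⟩).1 h') ((hH ⟨k, hk⟩ ⟨l, hl⟩).1 h''))

theorem memDias_iff (D : List Diamond) (x u : Fin n) :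
    MemDias n H R D x u ↔ e u ∈ F.diasSet D {y | F.H (e x) y} := by
  induction D generalizing u with
  | nil => exact hH x u
  | cons d D ih =>
    cases d
    · exact exists_lt_iff_exists e fun v => and_congr (hR v u) (ih v)
    · exact exists_lt_iff_exists e fun v => and_congr (hH v u)
        (exists_lt_iff_exists e fun w => and_congr (hR v w) (ih w))

theorem condCode_iff (b : Bool) (D : List Diamond) : CondCode n H R b D ↔ F.Cond b D := by
  cases b
  · exact forall_lt_iff_forall e fun u => memDias_iff e hH hR D u u
  · exact forall_lt_iff_forall e fun v => forall_lt_iff_forall e fun u =>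
      imp_congr (hR v u) (memDias_iff e hH hR D v u)

/-- If a truth table agrees with satisfaction below a compound formula, then it is locally correct at
that formula if and only if it agrees with satisfaction there. -/
theorem locallyCorrect_toNat_iff {V : Valuation F} {χ : Form}
    (hT : ∀ ψ, Form.toNat ψ < Form.toNat χ → ∀ u : Fin n, T (Form.toNat ψ) u ↔ Sat F V ψ (e u))
    (hχ : ∀ p, χ ≠ var p) (u : Fin n) :
    LocallyCorrect n H R T (Form.toNat χ) u ↔ (T (Form.toNat χ) u ↔ Sat F V χ (e u)) := by
  cases χ with
  | bot => exact LocallyCorrect.bot_iff.trans (iff_of_eq (iff_false _)).symm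
  | top => exact LocallyCorrect.top_iff.trans (iff_of_eq (iff_true _)).symm
  | var p => exact absurd rfl (hχ p)
  | and φ ψ =>
    have h₁ := Nat.left_le_pair (Form.toNat φ) (Form.toNat ψ)
    have h₂ := Nat.right_le_pair (Form.toNat φ) (Form.toNat ψ)
    simp only [Form.toNat] at hT
    exact (LocallyCorrect.and_iff φ ψ).trans (iff_congr .rfl
      (and_congr (hT φ (by omega) u) (hT ψ (by omega) u)))
  | or φ ψ =>
    have h₁ := Nat.left_le_pair (Form.toNat φ) (Form.toNat ψ)
    have h₂ := Nat.right_le_pair (Form.toNat φ) (Form.toNat ψ)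
    simp only [Form.toNat] at hT
    exact (LocallyCorrect.or_iff φ ψ).trans (iff_congr .rfl
      (or_congr (hT φ (by omega) u) (hT ψ (by omega) u)))
  | imp φ ψ =>
    have h₁ := Nat.left_le_pair (Form.toNat φ) (Form.toNat ψ)
    have h₂ := Nat.right_le_pair (Form.toNat φ) (Form.toNat ψ)
    simp only [Form.toNat] at hT
    exact (LocallyCorrect.imp_iff φ ψ).trans (iff_congr .rfl
      (forall_lt_iff_forall e fun v => imp_congr (hH u v)
        (imp_congr (hT φ (by omega) v) (hT ψ (by omega) v))))
  | coimp φ ψ =>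
    have h₁ := Nat.left_le_pair (Form.toNat φ) (Form.toNat ψ)
    have h₂ := Nat.right_le_pair (Form.toNat φ) (Form.toNat ψ)
    simp only [Form.toNat] at hT
    exact (LocallyCorrect.coimp_iff φ ψ).trans (iff_congr .rfl
      (exists_lt_iff_exists e fun v => and_congr (hH v u)
        (and_congr (hT φ (by omega) v) (not_congr (hT ψ (by omega) v)))))
  | bdia φ =>
    simp only [Form.toNat] at hT
    exact (LocallyCorrect.bdia_iff φ).trans (iff_congr .rfl
      (exists_lt_iff_exists e fun v => and_congr (hR v u) (hT φ (by omega) v)))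
  | box φ =>
    simp only [Form.toNat] at hT
    exact (LocallyCorrect.box_iff φ).trans (iff_congr .rfl
      (forall_lt_iff_forall e fun v => imp_congr (hR u v) (hT φ (by omega) v)))

theorem locallyCorrect_of_sat {V : Valuation F} {N k : ℕ}
    (hT : ∀ ψ, Form.toNat ψ < N + 1 → ∀ u : Fin n, T (Form.toNat ψ) u ↔ Sat F V ψ (e u))
    (hk : k < N + 1) (u : Fin n) : LocallyCorrect n H R T k u := by
  obtain ⟨χ, rfl⟩ : ∃ χ, k = Form.toNat χ := ⟨Form.ofNat k, (Form.toNat_ofNat k).symm⟩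
  by_cases hχ : ∃ p, χ = var p
  · obtain ⟨p, rfl⟩ := hχ
    refine (LocallyCorrect.var_iff p).2 fun v hv huv hu => (hT _ hk ⟨v, hv⟩).2 ?_
    exact V.isHSet p _ _ ((hH u ⟨v, hv⟩).1 huv) ((hT _ hk u).1 hu)
  · exact (locallyCorrect_toNat_iff e hH hR (fun ψ hψ => hT ψ (hψ.trans hk))
      (not_exists.1 hχ) u).2 (hT χ hk u)

/-- Each compound row is determined by rows with smaller codes, so local checks and the variable
rows fix the whole table by strong induction on codes. -/
theorem sat_iff_of_locallyCorrect {V : Valuation F} {N : ℕ}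
    (hV : ∀ p, Form.toNat (var p) < N + 1 → ∀ u : Fin n,
      T (Form.toNat (var p)) u ↔ e u ∈ V.val p)
    (hT : ∀ k < N + 1, ∀ u < n, LocallyCorrect n H R T k u) (φ : Form)
    (hφ : Form.toNat φ < N + 1) (u : Fin n) : T (Form.toNat φ) u ↔ Sat F V φ (e u) := by
  induction hk : Form.toNat φ using Nat.strong_induction_on generalizing φ u with
  | _ k ih =>
    subst hk
    by_cases hχ : ∃ p, φ = var p
    · obtain ⟨p, rfl⟩ := hχ
      exact hV p hφ u
    · exact (locallyCorrect_toNat_iff e hH hR (fun ψ hψ v => ih _ hψ ψ (hψ.trans hφ) v rfl)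
        (not_exists.1 hχ) u).1 (hT _ hφ u u.2)

end Correctness

/-! ### Bounded refutability, the finite model property and decidability -/

/-- The frame with states `0, …, n - 1` given by relations on `ℕ`. -/
def FrameCode.toHFrame {n : ℕ} {H R : ℕ → ℕ → Prop} (h : FrameCode n H R) (hn : 0 < n) :
    HFrame where
  U := Fin n
  nonempty := ⟨⟨0, hn⟩⟩
  H i j := H i j
  R i j := R i j
  refl i := h.1 i i.2
  trans i j k := h.2.1 i i.2 j j.2 k k.2
  stable i j k l := h.2.2 i i.2 j j.2 k k.2 l l.2

theorem refutable_iff (C : Set (Bool × List Diamond)) (φ : Form) :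
    Refutable C (Form.toNat φ) ↔ ∃ (F : HFrame) (V : Valuation F) (u : F.U), Finite F.U ∧
      Nat.card F.U ≤ 2 ^ (Form.toNat φ + 1) ∧ (∀ c ∈ C, F.Cond c.1 c.2) ∧ ¬ Sat F V φ u := by
  constructor
  · rintro ⟨n, hn, h, -, r, -, t, -, hF, hC, hT, u, hu, hs⟩
    let F := hF.toHFrame (u.zero_le.trans_lt hu)
    -- Variables with code above that of `φ` have no row in the table and are given the empty set.
    let V : Valuation F :=
      { val p := {i : Fin n | Form.toNat (var p) < Form.toNat φ + 1 ∧
          bitRel n t (Form.toNat (var p)) i}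
        isHSet := by
          rintro p (i : Fin n) (j : Fin n) hij ⟨hp, hi⟩
          exact ⟨hp, (LocallyCorrect.var_iff p).1 (hT _ hp i i.2) j j.2 hij hi⟩ }
    let e : Fin n ≃ F.U := Equiv.refl _
    have hH : ∀ i j : Fin n, bitRel n h i j ↔ F.H (e i) (e j) := fun _ _ => .rfl
    have hR : ∀ i j : Fin n, bitRel n r i j ↔ F.R (e i) (e j) := fun _ _ => .rfl
    refine ⟨F, V, e ⟨u, hu⟩, inferInstanceAs (Finite (Fin n)), ?_, fun c hc =>
      (condCode_iff e hH hR c.1 c.2).1 (hC c hc), fun hsat => hs ?_⟩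
    · rw [← Nat.card_congr e, Nat.card_fin]
      omega
    · exact (sat_iff_of_locallyCorrect (V := V) e hH hR
        (fun p hp i => ⟨fun hi => ⟨hp, hi⟩, fun hi => hi.2⟩) hT φ
        (Nat.lt_succ_self _) ⟨u, hu⟩).2 hsat
  · rintro ⟨F, V, u, hfin, hcard, hC, hu⟩
    let e : Fin (Nat.card F.U) ≃ F.U := (Finite.equivFin F.U).symm
    obtain ⟨h, hh, hH⟩ := exists_bitRel _ _ fun i j => F.H (e i) (e j)
    obtain ⟨r, hr, hR⟩ := exists_bitRel _ _ fun i j => F.R (e i) (e j)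
    obtain ⟨t, ht, hT⟩ := exists_bitRel (Form.toNat φ + 1) (Nat.card F.U) fun k j =>
      Sat F V (Form.ofNat k) (e j)
    have hT' : ∀ ψ, Form.toNat ψ < Form.toNat φ + 1 → ∀ u : Fin (Nat.card F.U),
        bitRel (Nat.card F.U) t (Form.toNat ψ) u ↔ Sat F V ψ (e u) := by
      intro ψ hψ u
      rw [hT ⟨Form.toNat ψ, hψ⟩ u, Form.ofNat_toNat]
    refine ⟨Nat.card F.U, Nat.lt_succ_of_le hcard, h, hh, r, hr, t, ht,
      frameCode_of_equiv e hH hR, fun c hc => (condCode_iff e hH hR c.1 c.2).2 (hC c hc),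
      fun k hk v hv => locallyCorrect_of_sat e hH hR hT' hk ⟨v, hv⟩, e.symm u, (e.symm u).2, ?_⟩
    rw [hT' φ (Nat.lt_succ_self _), e.apply_symm_apply]
    exact hu

theorem isBistLogic_biSKtExt (S : Set Form) : IsBistLogic (BiSKtExt S) where
  ax φ h _ hL := hL.1.ax φ h
  mp φ ψ h k _ hL := hL.1.mp φ ψ (h _ hL) (k _ hL)
  us σ φ h L hL := hL.1.us σ φ (h L hL)
  mon_coimp δ₁ δ₂ ψ h L hL := hL.1.mon_coimp δ₁ δ₂ ψ (h L hL)
  mon_box φ ψ h L hL := hL.1.mon_box φ ψ (h L hL)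
  mon_bdia φ ψ h L hL := hL.1.mon_bdia φ ψ (h L hL)

/-- Validity of the whole logic on such frames follows from minimality: the formulas valid in a
frame form a bist-logic, which here contains `S`. -/
theorem exists_conds {S : Set Form} (hS : S.Finite) (hd : ∀ φ ∈ S, IsDiamondAxiom φ) :
    ∃ C : Set (Bool × List Diamond), C.Finite ∧
      (∀ c ∈ C, ∃ p, diamondAxiom c.1 p c.2 ∈ BiSKtExt S) ∧
      ∀ F : HFrame, (∀ c ∈ C, F.Cond c.1 c.2) → ∀ ψ ∈ BiSKtExt S, F.Valid ψ := by
  have h : ∀ φ ∈ S, ∃ c : Bool × List Diamond, ∃ p, φ = diamondAxiom c.1 p c.2 := by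
    intro φ hφ
    obtain ⟨p, D, h | h⟩ := hd φ hφ
    · exact ⟨(false, D), p, h⟩
    · exact ⟨(true, D), p, h⟩
  choose! g p hg using h
  refine ⟨g '' S, hS.image g, ?_, fun F hF ψ hψ => hψ _ ⟨isBistLogic_valid F, fun φ hφ => ?_⟩⟩
  · rintro _ ⟨φ, hφ, rfl⟩
    refine ⟨p φ, fun L hL => hL.2 ?_⟩
    rwa [← hg φ hφ]
  · change F.Valid φ
    rw [hg φ hφ]
    exact (hF _ ⟨φ, hφ, rfl⟩).valid _

theorem hasFMP_and_isDecidable {S : Set Form} (hS : S.Finite)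
    (hd : ∀ φ ∈ S, IsDiamondAxiom φ) :
    HasFMP (BiSKtExt S) ∧ IsDecidable (BiSKtExt S) := by
  obtain ⟨C, hCfin, hC, hval⟩ := exists_conds hS hd
  have key := fun φ => (isBistLogic_biSKtExt S).exists_finite_countermodel hC (φ := φ)
  constructor
  · intro φ hφ
    obtain ⟨F, V, u, hfin, -, hF, hu⟩ := key φ hφ
    exact ⟨F, hfin, hval F hF, fun h => hu (h V u)⟩
  · have hprim : PrimrecPred fun φ : Form => ¬ Refutable C (Form.toNat φ) :=
      ((primrecPred_refutable hCfin).comp (Primrec.of_equiv (e := equivNat))).not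
    -- Theoremhood is the absence of a bounded countermodel: one direction is the bounded finite
    -- model property, the other is soundness.
    refine (hprim.of_eq fun φ => ?_).computablePred
    rw [refutable_iff]
    refine ⟨fun h => by_contra fun hφ => h (key φ hφ), ?_⟩
    rintro hφ ⟨F, V, u, -, -, hF, hu⟩
    exact hu (hval F hF φ hφ V u)

theorem biSKtExt_empty : BiSKtExt ∅ = BiSKt := by
  simp [BiSKtExt, BiSKt]

end BiSK

theorem theorem4 :
    (∀ S : Set BiSK.Form, S.Finite → (∀ φ ∈ S, BiSK.IsDiamondAxiom φ) →
      BiSK.HasFMP (BiSK.BiSKtExt S) ∧ BiSK.IsDecidable (BiSK.BiSKtExt S)) ∧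
    BiSK.IsDecidable BiSK.BiSKt := by
  refine ⟨fun S hS hd => BiSK.hasFMP_and_isDecidable hS hd, ?_⟩
  rw [← BiSK.biSKtExt_empty]
  exact (BiSK.hasFMP_and_isDecidable Set.finite_empty (by simp)).2
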